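/- Let $n\ge 2$, let $U\subset\mathbb R^n$ be open and connected, and let $\chi$ be a smooth real function on $\mathbb R^n$ that vanishes in a ball around $0$ and equals $1$ outside the unit ball. **Symbols.** For $a\in\mathbb C$, $CS^a_{\rm cpt}(U)$ is the set of smooth functions $\sigma(x,\xi)$ on $U\times\mathbb R^n$ for which there are functions $\sigma_{a-j}(x,\xi)$ ($j\ge0$), smooth for $\xi\ne0$ and positively homogeneous of degree $a-j$ in $\xi$, such that for each $N\ge 0$ the remainder $\sigma_{(N)}=\sigma-\sum_{j<N}\chi\,\sigma_{a-j}$ is smooth, vanishes for $x$ outside some compact subset of $U$, and satisfies $|\partial_x^\gamma\partial_\xi^\beta\sigma_{(N)}(x,\xi)|\le C_{\gamma,\beta,N}(1+|\xi|)^{{\rm Re}(a)-N-|\beta|}$ for all multi-indices $\gamma,\beta$. It carries the topology of the seminorms $\sup(1+|\xi|)^{-{\rm Re}(a)+N+|\beta|}|\partial_x^\gamma\partial_\xi^\beta\sigma_{(N)}|$ ($N\ge0$) and $\sup_{x,|\xi|=1}|\partial_x^\gamma\partial_\xi^\beta\sigma_{a-j}|$. Put $CS_{\rm cpt}(U)={\rm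 span}\bigcup_aCS^a_{\rm cpt}(U)$ and $CS^{-\infty}_{\rm cpt}(U)=\bigcap_aCS_{\rm cpt}^a(U)$. The sets $CS^a_{\rm c.c}(\mathbb R^n)$, $CS_{\rm c.c}(\mathbb R^n)$, $CS_{\rm c.c}^{-\infty}(\mathbb R^n)$ are defined in the same way with functions of $\xi$ only. On $CS_{\rm c.c}(\mathbb R^n)$ put ${\rm res}(\sigma)=(2\pi)^{-n/2}\int_{S^{n-1}}\sigma_{-n}$, and let the cut-off integral $\mathrm{fp}\!\!\int_{\mathbb R^n}\sigma$ be the Hadamard finite part of $\int_{|\xi|<R}\sigma(\xi)\,d\xi$ as $R\to\infty$, i.e. the constant term of its expansion in powers $R^z$ with $z\neq0$ and $\log R$. For $\sigma\in CS_{\rm cpt}(U)$ put $\mathrm{fp}\!\!\int_{T^*U}\sigma=\int_U\big(\mathrm{fp}\!\!\int_{\mathbb R^n}\sigma(x,\cdot)\big)dx$. **Hypotheses.** Let $D\subset CS_{\rm cpt}(U)$ be a set such that each element of $D$ is a finite sum of elements of $\bigcup_a (D\cap CS_{\rm cpt}^a(U))$ whose partial sums lie in $D$ (for instance, $D$ consists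 of symbols that have an order). Assume $CS_{\rm cpt}^{-\infty}(U)\subset D$ and $C_c^\infty(U)\cdot D\subset D$. Put $$S=\{\sigma\in CS_{\rm c.c}(\mathbb R^n):\ f\otimes\sigma\in D\ \ \forall f\in C_c^\infty(U)\},$$ and assume that 1. $CS^{-\infty}_{\rm c.c}(\mathbb R^n)\subset S\subset{\rm Ker}({\rm res})$; 2. for all $a\in\mathbb C$ and $\sigma\in S\cap CS_{\rm c.c}^a(\mathbb R^n)$ there are $\tau_1,\dots,\tau_n\in CS_{\rm c.c}^{a+1}(\mathbb R^n)$, $\tau_i\sim\sum_j\chi\,\tau_{i,a+1-j}$, such that $\sigma-\sum_i\partial_i\tau_i$ is smoothing and all $\tau_i$, $\partial_i\tau_i$ and $\chi\,\tau_{i,a+1-j}$ lie in $S$; 3. $\mathrm{fp}\!\!\int_{\mathbb R^n}$ has Stokes' property on $S$: $\mathrm{fp}\!\!\int_{\mathbb R^n}\partial_i\tau=0$ whenever $\tau\in CS_{\rm c.c}(\mathbb R^n)$ and $\partial_i\tau\in S$; 4. for each $a\in\mathbb C$, $C_c^\infty(U)\otimes(S\cap CS^a_{\rm c.c}(\mathbb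 R^n))$ (the span of the $f\otimes\sigma$) is a dense subset of $D\cap CS^a_{\rm cpt}(U)$. Let $\rho:D\to\mathbb C$ be * linear: $\rho(c_1\sigma_1+c_2\sigma_2)=c_1\rho(\sigma_1)+c_2\rho(\sigma_2)$ whenever $\sigma_1,\sigma_2,c_1\sigma_1+c_2\sigma_2\in D$; * continuous: for each $a\in\mathbb C$ and each compact $K\subset U$, $\rho$ is continuous on the set of elements of $D\cap CS_{\rm cpt}^a(U)$ that vanish for $x\notin K$; * with Stokes' property: $\rho(\sigma)=0$ whenever $\sigma\in D$ and $\sigma=\partial_{\xi_i}\tau$ or $\sigma=\partial_{x_i}\tau$ for some $i$ and some $\tau\in CS_{\rm cpt}(U)$. **Conclusion.** There is $c\in\mathbb C$ with $\rho(\sigma)=c\,\mathrm{fp}\!\!\int_{T^*U}\sigma$ for all $\sigma\in D$. -/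

import Mathlib

open Set Filter Topology MeasureTheory
open scoped ContDiff

noncomputable section

namespace StokesSymbols

/-- Euclidean space `ℝⁿ`. -/
abbrev Pt (n : ℕ) : Type := EuclideanSpace ℝ (Fin n)

/-- Functions `σ(ξ)` on `ℝⁿ`. -/
abbrev Fun1 (n : ℕ) : Type := Pt n → ℂ

/-- Functions `σ(x, ξ)` on `ℝⁿ × ℝⁿ`. A symbol on `U × ℝⁿ` with compact support in `U` is
identified with its extension by zero. -/
abbrev Fun2 (n : ℕ) : Type := Pt n → Pt n → ℂ

variable {n : ℕ}

/-- The `i`-th vector of the canonical basis. -/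
def basisVec (i : Fin n) : Pt n := EuclideanSpace.single i (1 : ℝ)

/-- `∂_i σ` for a function on `ℝⁿ`. -/
def pd (i : Fin n) (σ : Fun1 n) : Fun1 n := fun ξ => fderiv ℝ σ ξ (basisVec i)

/-- `∂_{x_i} σ`. -/
def pdx (i : Fin n) (σ : Fun2 n) : Fun2 n := fun x ξ => fderiv ℝ (fun y => σ y ξ) x (basisVec i)

/-- `∂_{ξ_i} σ`. -/
def pdxi (i : Fin n) (σ : Fun2 n) : Fun2 n := fun x ξ => fderiv ℝ (fun η => σ x η) ξ (basisVec i)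

/-- `∂^β σ`. A multi-index is written as the word of its indices, so that `|β|` is its length. -/
def iterPd (β : List (Fin n)) (σ : Fun1 n) : Fun1 n := β.foldr pd σ

/-- `∂_x^γ ∂_ξ^β σ`. -/
def iterPd2 (γ β : List (Fin n)) (σ : Fun2 n) : Fun2 n := γ.foldr pdx (β.foldr pdxi σ)

/-- A smooth cut-off function: it vanishes in a ball centred at `0` and is equal to `1` outside
the unit ball. -/
def IsCutoff (χ : Pt n → ℝ) : Prop :=
  ContDiff ℝ ∞ χ ∧ (∃ r > 0, ∀ ξ, ‖ξ‖ < r → χ ξ = 0) ∧ ∀ ξ, 1 ≤ ‖ξ‖ → χ ξ = 1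

/-! ### Symbols with constant coefficients -/

/-- The symbol estimates of order `m`, where `m` is the real part of the order. -/
def IsSymbolCC (m : ℝ) (σ : Fun1 n) : Prop :=
  ContDiff ℝ ∞ σ ∧
    ∀ β : List (Fin n), ∃ C : ℝ, ∀ ξ, ‖iterPd β σ ξ‖ ≤ C * (1 + ‖ξ‖) ^ (m - β.length)

/-- `σ ∼ ∑_j χ σ_{a-j}`, where `s j` is the component `σ_{a-j}`, smooth away from `0` and positively
homogeneous of degree `a - j` there: each remainder `σ_(N)` is a symbol of order `a - N`. -/
def IsExpansionCC (χ : Pt n → ℝ) (a : ℂ) (σ : Fun1 n) (s : ℕ → Fun1 n) : Prop :=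
  (∀ j, ContDiffOn ℝ ∞ (s j) {0}ᶜ) ∧
  (∀ j, ∀ ξ, ξ ≠ 0 → ∀ t : ℝ, 0 < t → s j (t • ξ) = (t : ℂ) ^ (a - j) * s j ξ) ∧
  ∀ N : ℕ, IsSymbolCC (a.re - N) (fun ξ => σ ξ - ∑ j ∈ Finset.range N, (χ ξ : ℂ) * s j ξ)

/-- Classical symbols of order `a` with constant coefficients. -/
def CSccOrd (χ : Pt n → ℝ) (a : ℂ) : Set (Fun1 n) := {σ | ∃ s, IsExpansionCC χ a σ s}

/-- All classical symbols with constant coefficients. The product of classical symbols of orders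
`a` and `b` is classical of order `a + b`, so the algebra that they generate is their span. -/
def CScc (χ : Pt n → ℝ) : Submodule ℂ (Fun1 n) := Submodule.span ℂ (⋃ a, CSccOrd χ a)

/-- Smoothing symbols with constant coefficients. -/
def CSccSmoothing (χ : Pt n → ℝ) : Set (Fun1 n) := ⋂ a, CSccOrd χ a

/-- The integral over the unit sphere against its standard volume measure. -/
def sphereIntegral (f : Fun1 n) : ℂ :=
  ∫ θ : Metric.sphere (0 : Pt n) 1, f θ ∂((volume : Measure (Pt n)).toSphere)

/-- `r = (2π)^{-n/2} ∫_S σ_{-n}`. A general symbol is a sum of symbols `τ k` of orders `a k`; its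
component of degree `-n` is the sum of their components `t k j` with `a k - j = -n` (at most one
`j` for each `k`). -/
def HasResidue (χ : Pt n → ℝ) (σ : Fun1 n) (r : ℂ) : Prop :=
  ∃ (m : ℕ) (a : Fin m → ℂ) (τ : Fin m → Fun1 n) (t : Fin m → ℕ → Fun1 n),
    (∀ k, IsExpansionCC χ (a k) (τ k) (t k)) ∧ σ = ∑ k, τ k ∧
    r = ((Real.sqrt (2 * Real.pi) ^ n : ℝ) : ℂ)⁻¹ *
      ∑ k, ∑ᶠ (j : ℕ) (_ : a k - j = -(n : ℂ)), sphereIntegral (t k j)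

open Classical in
/-- The noncommutative residue of a classical symbol with constant coefficients. -/
def residue (χ : Pt n → ℝ) (σ : Fun1 n) : ℂ :=
  if h : ∃ r, HasResidue χ σ r then h.choose else 0

/-- `c` is the Hadamard finite part of `F` as `R → ∞`: the constant term of an expansion of `F`, up
to `o(1)`, in complex powers of `R` with non-zero exponents and `log R`. -/
def HasFinitePart (F : ℝ → ℂ) (c : ℂ) : Prop :=
  ∃ (Z : Finset ℂ) (k : ℂ → ℂ) (b : ℂ), (0 : ℂ) ∉ Z ∧
    Tendsto (fun R : ℝ => F R - ∑ z ∈ Z, k z * (R : ℂ) ^ z - b * (Real.log R : ℂ)) atTop (𝓝 c)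

open Classical in
/-- The cut-off regularised integral over `ℝⁿ`: the finite part, as `R → ∞`, of the integral over
the ball of radius `R`. -/
def cutoffIntegral (σ : Fun1 n) : ℂ :=
  if h : ∃ c, HasFinitePart (fun R => ∫ ξ in Metric.ball (0 : Pt n) R, σ ξ) c then h.choose else 0

/-- Stokes' property of `ρ` on a set `S` of symbols with constant coefficients: `ρ` vanishes on the
partial derivatives of symbols that lie in `S`. -/
def StokesCC (χ : Pt n → ℝ) (S : Set (Fun1 n)) (ρ : Fun1 n → ℂ) : Prop :=
  ∀ τ ∈ CScc χ, ∀ i : Fin n, pd i τ ∈ S → ρ (pd i τ) = 0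

/-- The requirements on a set `S` of symbols with constant coefficients. -/
structure IsAdmissible (χ : Pt n → ℝ) (S : Set (Fun1 n)) : Prop where
  smoothing_subset : CSccSmoothing χ ⊆ S
  subset_ker_residue : ∀ σ ∈ S, σ ∈ CScc χ ∧ residue χ σ = 0
  /-- Modulo smoothing symbols, each `σ ∈ S` of order `a` is a sum of derivatives `∂_i τ_i` with
  `τ_i ∼ ∑_j χ τ_{i,a+1-j}` of order `a + 1`, where the `τ_i`, the `∂_i τ_i` and the
  `χ τ_{i,a+1-j}` lie in `S`. -/
  exists_primitives : ∀ a : ℂ, ∀ σ ∈ S, σ ∈ CSccOrd χ a →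
    ∃ (τ : Fin n → Fun1 n) (t : Fin n → ℕ → Fun1 n),
      (∀ i, IsExpansionCC χ (a + 1) (τ i) (t i)) ∧
      σ - ∑ i, pd i (τ i) ∈ CSccSmoothing χ ∧
      (∀ i, τ i ∈ S) ∧ (∀ i, pd i (τ i) ∈ S) ∧
      ∀ i j, (fun ξ => (χ ξ : ℂ) * t i j ξ) ∈ S
  stokes_cutoffIntegral : StokesCC χ S cutoffIntegral

/-! ### Symbols with compact support in `U` -/

/-- The symbol estimates of order `m` for `σ(x, ξ)`, with compact support in `U`. -/
def IsSymbol (U : Set (Pt n)) (m : ℝ) (σ : Fun2 n) : Prop :=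
  ContDiff ℝ ∞ (fun p : Pt n × Pt n => σ p.1 p.2) ∧
  (∃ K, IsCompact K ∧ K ⊆ U ∧ ∀ x, x ∉ K → ∀ ξ, σ x ξ = 0) ∧
  ∀ γ β : List (Fin n), ∃ C : ℝ, ∀ x ξ,
    ‖iterPd2 γ β σ x ξ‖ ≤ C * (1 + ‖ξ‖) ^ (m - β.length)

/-- The remainder `σ_(N) = σ - ∑_{j<N} χ σ_{a-j}`. -/
def remainder (χ : Pt n → ℝ) (σ : Fun2 n) (s : ℕ → Fun2 n) (N : ℕ) : Fun2 n :=
  fun x ξ => σ x ξ - ∑ j ∈ Finset.range N, (χ ξ : ℂ) * s j x ξ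

/-- `σ ∼ ∑_j χ σ_{a-j}`, where `s j` is the component `σ_{a-j}`. -/
def IsExpansion (χ : Pt n → ℝ) (U : Set (Pt n)) (a : ℂ) (σ : Fun2 n) (s : ℕ → Fun2 n) : Prop :=
  (∀ j, ContDiffOn ℝ ∞ (fun p : Pt n × Pt n => s j p.1 p.2) (univ ×ˢ {0}ᶜ)) ∧
  (∀ j x, ∀ ξ, ξ ≠ 0 → ∀ t : ℝ, 0 < t → s j x (t • ξ) = (t : ℂ) ^ (a - j) * s j x ξ) ∧
  ∀ N : ℕ, IsSymbol U (a.re - N) (remainder χ σ s N)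

/-- Classical symbols of order `a` with compact support in `U`. -/
def CScptOrd (χ : Pt n → ℝ) (U : Set (Pt n)) (a : ℂ) : Set (Fun2 n) :=
  {σ | ∃ s, IsExpansion χ U a σ s}

/-- All classical symbols with compact support in `U`; as for constant coefficients, the algebra
generated by the classical symbols of all orders is their span. -/
def CScpt (χ : Pt n → ℝ) (U : Set (Pt n)) : Submodule ℂ (Fun2 n) :=
  Submodule.span ℂ (⋃ a, CScptOrd χ U a)

/-- Smoothing symbols with compact support in `U`. -/
def CScptSmoothing (χ : Pt n → ℝ) (U : Set (Pt n)) : Set (Fun2 n) := ⋂ a, CScptOrd χ U a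

/-- The basic neighbourhoods of `0` for the Fréchet structure of the symbols of order `a`: all the
seminorms
`sup (1+|ξ|)^{-Re a+|β|} |∂_x^γ ∂_ξ^β σ|`,
`sup (1+|ξ|)^{-Re a+N+|β|} |∂_x^γ ∂_ξ^β σ_(N)|`,
`sup_{|ξ|=1} |∂_x^γ ∂_ξ^β σ_{a-j}|`
with `|γ|, |β|, N, j ≤ m` are at most `ε`. The first seminorms are the second ones for `N = 0`. -/
def SeminormsLE (χ : Pt n → ℝ) (U : Set (Pt n)) (a : ℂ) (m : ℕ) (ε : ℝ) (σ : Fun2 n) : Prop :=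
  ∃ s, IsExpansion χ U a σ s ∧
    ∀ γ β : List (Fin n), γ.length ≤ m → β.length ≤ m →
      (∀ N ≤ m, ∀ x ξ,
        (1 + ‖ξ‖) ^ (-a.re + N + β.length) * ‖iterPd2 γ β (remainder χ σ s N) x ξ‖ ≤ ε) ∧
      ∀ j ≤ m, ∀ x ξ, ‖ξ‖ = 1 → ‖iterPd2 γ β (s j) x ξ‖ ≤ ε

/-- Smooth complex functions with compact support in `U`. -/
def TestFun (U : Set (Pt n)) : Set (Pt n → ℂ) :=
  {f | ContDiff ℝ ∞ f ∧ HasCompactSupport f ∧ tsupport f ⊆ U}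

/-- `f ⊗ σ`. -/
def tensor (f : Pt n → ℂ) (σ : Fun1 n) : Fun2 n := fun x ξ => f x * σ ξ

/-- The constant-coefficient slice `S` of `D`. -/
def slice (χ : Pt n → ℝ) (U : Set (Pt n)) (D : Set (Fun2 n)) : Set (Fun1 n) :=
  {σ | σ ∈ CScc χ ∧ ∀ f ∈ TestFun U, tensor f σ ∈ D}

/-- The tensor product of the test functions with the part of order `a` of `S`. -/
def tensorSpan (χ : Pt n → ℝ) (U : Set (Pt n)) (S : Set (Fun1 n)) (a : ℂ) :
    Submodule ℂ (Fun2 n) :=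
  Submodule.span ℂ {g | ∃ f ∈ TestFun U, ∃ σ ∈ S ∩ CSccOrd χ a, g = tensor f σ}

/-- `T` is a dense subset of `A`, for the topology of the symbols of order `a`. -/
def IsDenseIn (χ : Pt n → ℝ) (U : Set (Pt n)) (a : ℂ) (T A : Set (Fun2 n)) : Prop :=
  T ⊆ A ∧ ∀ σ ∈ A, ∀ (m : ℕ) (ε : ℝ), 0 < ε → ∃ τ ∈ T, SeminormsLE χ U a m ε (τ - σ)

/-- Linearity of `ρ` on a set `D` that need not be a linear space. Only the values of `ρ` on `D`
matter. -/
def IsLinearOn (D : Set (Fun2 n)) (ρ : Fun2 n → ℂ) : Prop :=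
  ∀ σ₁ ∈ D, ∀ σ₂ ∈ D, ∀ c₁ c₂ : ℂ, c₁ • σ₁ + c₂ • σ₂ ∈ D →
    ρ (c₁ • σ₁ + c₂ • σ₂) = c₁ * ρ σ₁ + c₂ * ρ σ₂

/-- Continuity of `ρ` on the symbols of fixed order in `D`: as for distributions on `U`, it is only
asked on the symbols that are supported in a fixed compact set. -/
def IsContinuousOnOrders (χ : Pt n → ℝ) (U : Set (Pt n)) (D : Set (Fun2 n))
    (ρ : Fun2 n → ℂ) : Prop :=
  ∀ (a : ℂ) (K : Set (Pt n)), IsCompact K → K ⊆ U →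
    ∀ σ ∈ D ∩ CScptOrd χ U a, (∀ x, x ∉ K → σ x = 0) →
      ∀ ε : ℝ, 0 < ε → ∃ (m : ℕ) (δ : ℝ), 0 < δ ∧
        ∀ τ ∈ D ∩ CScptOrd χ U a, (∀ x, x ∉ K → τ x = 0) →
          SeminormsLE χ U a m δ (τ - σ) → ‖ρ τ - ρ σ‖ < ε

/-- Stokes' property of `ρ` on `D`. -/
def Stokes (χ : Pt n → ℝ) (U : Set (Pt n)) (D : Set (Fun2 n)) (ρ : Fun2 n → ℂ) : Prop :=
  ∀ τ ∈ CScpt χ U, ∀ i : Fin n,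
    (pdxi i τ ∈ D → ρ (pdxi i τ) = 0) ∧ (pdx i τ ∈ D → ρ (pdx i τ) = 0)

/-- The cut-off regularised integral over `T*U`. -/
def cutoffIntegralCotangent (U : Set (Pt n)) (σ : Fun2 n) : ℂ := ∫ x in U, cutoffIntegral (σ x)

/-- Each element of `D` is built inside `D` by adding up finitely many elements of `D`, each of
which has an order. -/
def IsSumOfOrders (χ : Pt n → ℝ) (U : Set (Pt n)) (D : Set (Fun2 n)) : Prop :=
  ∀ σ ∈ D, ∃ (m : ℕ) (τ : ℕ → Fun2 n),
    (∀ k < m, ∃ a, τ k ∈ D ∩ CScptOrd χ U a) ∧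
    (∀ k ≤ m, ∑ i ∈ Finset.range k, τ i ∈ D) ∧
    σ = ∑ i ∈ Finset.range m, τ i

end StokesSymbols

end

open Set Filter Topology MeasureTheory
open scoped ContDiff

noncomputable section

namespace StokesSymbols

variable {n : ℕ}

/-! The heart of the matter is algebraic: a linear functional on `C_c^∞` of a connected open set
that kills all partial derivatives is a multiple of the integral
(`KillsDerivatives.exists_eq_integral`), and no continuity is needed for this. The function `f ∫ φ -
φ ∗ f` is an explicit sum of derivatives of test functions, so such a functional `T` satisfies `T f
∫ φ = T (φ ∗ f)`. Since convolution is commutative, `T f ∫ φ = T φ ∫ f` on small balls, and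
connectedness makes the local constants agree.

Stokes' property allows this to be applied to `ρ (f ⊗ r)` in each factor separately: in `f` over
`U`, and in `r` over `ℝⁿ`, first for `r` of compact support and then for all smoothing `r` by
truncation and continuity of `ρ`. Hence `ρ (f ⊗ r) = c ∫ f ∫ r` with one constant `c`
(`exists_rho_smoothing`). A symbol `σ` in the slice `S` is `r + ∑ ∂_i τ_i` with `r` smoothing. Both
`ρ (f ⊗ ·)` and the cut-off integral kill the derivatives, so the same `c` works for `f ⊗ σ`
(`rho_tensor`) and then for the span of these tensors.

To pass to all of `D ∩ CS^a` by density, both sides must be continuous. For `ρ` this is assumed on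
symbols with supports in a fixed compact set, and multiplication of the approximants by a test
function equal to `1` on the support of the limit provides such a set. For the cut-off integral it
is proved: finitely many seminorms of order `a` bound the fibrewise integrals uniformly in `x`
(`exists_cutoffIntegral_bound`, `hasCotangentIntegral_of_approx`). This rests on polar coordinates
for the homogeneous components, integrability of a late remainder, and uniqueness of finite parts,
which makes the chosen value additive. Elements of `D` are finally reached by adding finitely many
symbols that have an order. -/

/-! ### Iterated partial derivatives and the Leibniz rule -/

lemma iterPd_cons (i : Fin n) (β : List (Fin n)) (σ : Fun1 n) :
    iterPd (i :: β) σ = pd i (iterPd β σ) := rfl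

lemma iterPd_pd (β : List (Fin n)) (i : Fin n) (σ : Fun1 n) :
    iterPd β (pd i σ) = iterPd (β ++ [i]) σ := by
  simp [iterPd, List.foldr_append]

/-- Smoothness is treated on an open set because homogeneous components are smooth only away from
the origin. -/
lemma contDiffOn_pd {σ : Fun1 n} {O : Set (Pt n)} (hO : IsOpen O) (h : ContDiffOn ℝ ∞ σ O)
    (i : Fin n) : ContDiffOn ℝ ∞ (pd i σ) O :=
  (h.fderiv_of_isOpen hO (m := ∞) (by simp)).clm_apply contDiffOn_const

lemma contDiffOn_iterPd {σ : Fun1 n} {O : Set (Pt n)} (hO : IsOpen O) (h : ContDiffOn ℝ ∞ σ O)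
    (β : List (Fin n)) : ContDiffOn ℝ ∞ (iterPd β σ) O := by
  induction β with
  | nil => exact h
  | cons i β ih => exact contDiffOn_pd hO ih i

lemma contDiff_pd {σ : Fun1 n} (h : ContDiff ℝ ∞ σ) (i : Fin n) : ContDiff ℝ ∞ (pd i σ) :=
  contDiffOn_univ.1 (contDiffOn_pd isOpen_univ h.contDiffOn i)

lemma contDiff_iterPd {σ : Fun1 n} (h : ContDiff ℝ ∞ σ) (β : List (Fin n)) :
    ContDiff ℝ ∞ (iterPd β σ) :=
  contDiffOn_univ.1 (contDiffOn_iterPd isOpen_univ h.contDiffOn β)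

lemma iterPd_eventuallyEq {f g : Fun1 n} {x : Pt n} (h : f =ᶠ[𝓝 x] g) (β : List (Fin n)) :
    iterPd β f =ᶠ[𝓝 x] iterPd β g := by
  induction β with
  | nil => exact h
  | cons i β ih =>
    filter_upwards [ih.fderiv (𝕜 := ℝ)] with y hy
    simp [iterPd_cons, pd, hy]

lemma differentiableAt_of_mem {E F : Type*} [NormedAddCommGroup E] [NormedSpace ℝ E]
    [NormedAddCommGroup F] [NormedSpace ℝ F] {σ : E → F} {O : Set E} (hO : IsOpen O)
    (h : ContDiffOn ℝ ∞ σ O) {x : E} (hx : x ∈ O) : DifferentiableAt ℝ σ x :=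
  (h.contDiffAt (hO.mem_nhds hx)).differentiableAt (by simp)

lemma iterPd_add {f g : Fun1 n} {O : Set (Pt n)} (hO : IsOpen O) (hf : ContDiffOn ℝ ∞ f O)
    (hg : ContDiffOn ℝ ∞ g O) (β : List (Fin n)) :
    EqOn (iterPd β (f + g)) (iterPd β f + iterPd β g) O := by
  induction β with
  | nil => exact fun _ _ => rfl
  | cons i β ih =>
    intro x hx
    have := (ih.eventuallyEq_of_mem (hO.mem_nhds hx)).fderiv_eq (𝕜 := ℝ)
    simp only [iterPd_cons, pd, this, Pi.add_apply]
    rw [fderiv_add (differentiableAt_of_mem hO (contDiffOn_iterPd hO hf β) hx)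
      (differentiableAt_of_mem hO (contDiffOn_iterPd hO hg β) hx)]
    rfl

lemma iterPd_const_mul {f : Fun1 n} {O : Set (Pt n)} (hO : IsOpen O) (hf : ContDiffOn ℝ ∞ f O)
    (c : ℂ) (β : List (Fin n)) :
    EqOn (iterPd β (fun x => c * f x)) (fun x => c * iterPd β f x) O := by
  induction β with
  | nil => exact fun _ _ => rfl
  | cons i β ih =>
    intro x hx
    have := (ih.eventuallyEq_of_mem (hO.mem_nhds hx)).fderiv_eq (𝕜 := ℝ)
    simp only [iterPd_cons, pd, this]
    rw [fderiv_const_mul (differentiableAt_of_mem hO (contDiffOn_iterPd hO hf β) hx)]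
    rfl

/-- The pairs of words into which a word splits in the Leibniz rule. -/
def splits : List (Fin n) → List (List (Fin n) × List (Fin n))
  | [] => [([], [])]
  | i :: β => (splits β).map (fun p => (i :: p.1, p.2)) ++ (splits β).map (fun p => (p.1, i :: p.2))

lemma length_splits (β : List (Fin n)) : (splits β).length = 2 ^ β.length := by
  induction β with
  | nil => rfl
  | cons i β ih => simp [splits, ih, pow_succ]; ring

lemma length_of_mem_splits {β : List (Fin n)} {p : List (Fin n) × List (Fin n)}
    (hp : p ∈ splits β) : p.1.length + p.2.length = β.length := by
  induction β generalizing p with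
  | nil => simp [splits] at hp; simp [hp]
  | cons i β ih =>
    simp only [splits, List.mem_append, List.mem_map] at hp
    rcases hp with ⟨q, hq, rfl⟩ | ⟨q, hq, rfl⟩ <;> have := ih hq <;> simp <;> omega

lemma pd_list_sum {ι : Type*} (l : List ι) (F : ι → Fun1 n) {x : Pt n} (i : Fin n)
    (h : ∀ p ∈ l, DifferentiableAt ℝ (F p) x) :
    pd i (fun y => (l.map fun p => F p y).sum) x = (l.map fun p => pd i (F p) x).sum ∧
      DifferentiableAt ℝ (fun y => (l.map fun p => F p y).sum) x := by
  induction l with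
  | nil => simp [pd]
  | cons p l ih =>
    obtain ⟨h1, h2⟩ := ih fun q hq => h q (List.mem_cons_of_mem _ hq)
    have h0 := h p List.mem_cons_self
    simp only [List.map_cons, List.sum_cons]
    refine ⟨?_, h0.add h2⟩
    rw [← h1]
    simp only [pd]
    rw [fderiv_fun_add h0 h2]
    rfl

/-- The Leibniz rule. -/
lemma iterPd_mul {f g : Fun1 n} {O : Set (Pt n)} (hO : IsOpen O) (hf : ContDiffOn ℝ ∞ f O)
    (hg : ContDiffOn ℝ ∞ g O) (β : List (Fin n)) :
    EqOn (iterPd β (fun x => f x * g x))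
      (fun x => ((splits β).map fun p => iterPd p.1 f x * iterPd p.2 g x).sum) O := by
  induction β with
  | nil => intro x _; simp [splits, iterPd]
  | cons i β ih =>
    intro x hx
    have h1 := (ih.eventuallyEq_of_mem (hO.mem_nhds hx)).fderiv_eq (𝕜 := ℝ)
    have hd : ∀ p : List (Fin n) × List (Fin n),
        DifferentiableAt ℝ (iterPd p.1 f) x ∧ DifferentiableAt ℝ (iterPd p.2 g) x := fun p =>
      ⟨differentiableAt_of_mem hO (contDiffOn_iterPd hO hf _) hx,
        differentiableAt_of_mem hO (contDiffOn_iterPd hO hg _) hx⟩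
    have h2 := (pd_list_sum (splits β) (fun p y => iterPd p.1 f y * iterPd p.2 g y) (x := x) i
      fun p _ => (hd p).1.mul (hd p).2).1
    have h3 : iterPd (i :: β) (fun x => f x * g x) x
        = pd i (fun y => ((splits β).map fun p => iterPd p.1 f y * iterPd p.2 g y).sum) x := by
      simp only [iterPd_cons, pd, h1]
    rw [h3, h2]
    simp only [splits, List.map_append, List.sum_append, List.map_map, Function.comp_def]
    rw [← List.sum_map_add]
    congr 1
    refine List.map_congr_left fun p _ => ?_
    simp only [pd, iterPd_cons]
    rw [fderiv_fun_mul (hd p).1 (hd p).2]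
    simp only [_root_.add_apply, _root_.smul_apply, smul_eq_mul]
    ring

lemma norm_list_sum_le {ι : Type*} (l : List ι) (F : ι → ℂ) (C : ℝ) (h : ∀ p ∈ l, ‖F p‖ ≤ C) :
    ‖(l.map F).sum‖ ≤ l.length * C := by
  induction l with
  | nil => simp
  | cons p l ih =>
    simp only [List.map_cons, List.sum_cons, List.length_cons, Nat.cast_add, Nat.cast_one]
    have h1 := ih fun q hq => h q (List.mem_cons_of_mem _ hq)
    have h2 := h p List.mem_cons_self
    linarith [norm_add_le (F p) ((l.map F).sum)]

lemma norm_iterPd_mul_le {f g : Fun1 n} {O : Set (Pt n)} (hO : IsOpen O)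
    (hf : ContDiffOn ℝ ∞ f O) (hg : ContDiffOn ℝ ∞ g O) (β : List (Fin n)) {x : Pt n}
    (hx : x ∈ O) {A B : ℝ}
    (hA : ∀ α : List (Fin n), α.length ≤ β.length → ‖iterPd α f x‖ ≤ A)
    (hB : ∀ α : List (Fin n), α.length ≤ β.length → ‖iterPd α g x‖ ≤ B) :
    ‖iterPd β (fun x => f x * g x) x‖ ≤ 2 ^ β.length * (A * B) := by
  rw [iterPd_mul hO hf hg β hx]
  refine (norm_list_sum_le _ _ (A * B) fun p hp => ?_).trans_eq (by rw [length_splits]; simp)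
  have := length_of_mem_splits hp
  rw [norm_mul]
  have hA' := hA p.1 (by omega)
  exact mul_le_mul hA' (hB p.2 (by omega)) (norm_nonneg _) ((norm_nonneg _).trans hA')

/-! ### Functions of two variables -/

lemma foldr_pdxi (β : List (Fin n)) (σ : Fun2 n) (x : Pt n) :
    β.foldr pdxi σ x = iterPd β (σ x) := by
  induction β with
  | nil => rfl
  | cons i β ih =>
    funext ξ
    simp only [List.foldr_cons, pdxi, iterPd_cons, pd]
    congr 2

/-- Freezing one variable at a time lets the estimates in two variables follow from the calculus in
one variable. -/
lemma iterPd2_apply (γ β : List (Fin n)) (σ : Fun2 n) (x ξ : Pt n) :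
    iterPd2 γ β σ x ξ = iterPd γ (fun y => iterPd β (σ y) ξ) x := by
  induction γ generalizing x with
  | nil => simp [iterPd2, iterPd, foldr_pdxi]
  | cons i γ ih =>
    simp only [iterPd_cons, pd]
    rw [← funext ih]
    rfl

lemma contDiffOn_pdxi {σ : Fun2 n} {O : Set (Pt n × Pt n)} (hO : IsOpen O)
    (h : ContDiffOn ℝ ∞ (fun p : Pt n × Pt n => σ p.1 p.2) O) (i : Fin n) :
    ContDiffOn ℝ ∞ (fun p : Pt n × Pt n => pdxi i σ p.1 p.2) O := by
  -- Joint smoothness is visible once the partial derivative is the total derivative in the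
  -- direction `(0, e_i)`.
  have h1 : ContDiffOn ℝ ∞ (fun p : Pt n × Pt n =>
      fderiv ℝ (fun q : Pt n × Pt n => σ q.1 q.2) p ((0 : Pt n), basisVec i)) O :=
    (h.fderiv_of_isOpen hO (m := ∞) (by simp)).clm_apply contDiffOn_const
  refine h1.congr fun p hp => ?_
  have h2 := (differentiableAt_of_mem hO h hp).hasFDerivAt
  have h3 : HasFDerivAt (fun η : Pt n => (p.1, η)) (ContinuousLinearMap.inr ℝ (Pt n) (Pt n)) p.2 :=
    hasFDerivAt_prodMk_right p.1 p.2
  have h4 := HasFDerivAt.comp (𝕜 := ℝ) p.2 (g := fun q : Pt n × Pt n => σ q.1 q.2) h2 h3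
  have h5 : fderiv ℝ (fun η => σ p.1 η) p.2 = _ := h4.fderiv
  simp [pdxi, h5]

lemma contDiffOn_foldr_pdxi {σ : Fun2 n} {O : Set (Pt n × Pt n)} (hO : IsOpen O)
    (h : ContDiffOn ℝ ∞ (fun p : Pt n × Pt n => σ p.1 p.2) O) (β : List (Fin n)) :
    ContDiffOn ℝ ∞ (fun p : Pt n × Pt n => iterPd β (σ p.1) p.2) O := by
  simp_rw [← foldr_pdxi]
  induction β with
  | nil => exact h
  | cons i β ih => exact contDiffOn_pdxi hO ih i

lemma contDiff_slice {σ : Fun2 n} {O : Set (Pt n)}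
    (h : ContDiffOn ℝ ∞ (fun p : Pt n × Pt n => σ p.1 p.2) (univ ×ˢ O)) (hO : IsOpen O)
    (β : List (Fin n)) {ξ : Pt n} (hξ : ξ ∈ O) :
    ContDiff ℝ ∞ (fun y => iterPd β (σ y) ξ) := by
  have h1 := contDiffOn_foldr_pdxi (isOpen_univ.prod hO) h β
  have h2 : ContDiff ℝ ∞ (fun y : Pt n => (y, ξ)) := contDiff_id.prodMk contDiff_const
  exact contDiffOn_univ.1 (h1.comp h2.contDiffOn fun y _ => ⟨mem_univ _, hξ⟩)

lemma contDiffOn_slice {σ : Fun2 n} {O : Set (Pt n)}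
    (h : ContDiffOn ℝ ∞ (fun p : Pt n × Pt n => σ p.1 p.2) (univ ×ˢ O)) (x : Pt n) :
    ContDiffOn ℝ ∞ (σ x) O := by
  have h2 : ContDiff ℝ ∞ (fun y : Pt n => (x, y)) := contDiff_const.prodMk contDiff_id
  exact h.comp h2.contDiffOn fun y hy => ⟨mem_univ _, hy⟩

/-- Multiplication by a function of `x`. -/
def mulX (f : Pt n → ℂ) (σ : Fun2 n) : Fun2 n := fun x ξ => f x * σ x ξ

/-- The factor `f` is constant in `ξ`, so only the `x`-derivatives need the Leibniz rule. -/
lemma iterPd2_mulX {f : Pt n → ℂ} {σ : Fun2 n} {O : Set (Pt n)} (hO : IsOpen O)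
    (h : ContDiffOn ℝ ∞ (fun p : Pt n × Pt n => σ p.1 p.2) (univ ×ˢ O))
    (γ β : List (Fin n)) (x : Pt n) {ξ : Pt n} (hξ : ξ ∈ O) :
    iterPd2 γ β (mulX f σ) x ξ = iterPd γ (fun y => f y * iterPd β (σ y) ξ) x := by
  rw [iterPd2_apply]
  congr 1
  funext y
  exact iterPd_const_mul hO (contDiffOn_slice h y) (f y) β hξ

lemma norm_iterPd2_mulX_le {f : Pt n → ℂ} (hf : ContDiff ℝ ∞ f) {σ : Fun2 n} {O : Set (Pt n)}
    (hO : IsOpen O) (h : ContDiffOn ℝ ∞ (fun p : Pt n × Pt n => σ p.1 p.2) (univ ×ˢ O))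
    (γ β : List (Fin n)) (x : Pt n) {ξ : Pt n} (hξ : ξ ∈ O) {A B : ℝ}
    (hA : ∀ α : List (Fin n), α.length ≤ γ.length → ‖iterPd α f x‖ ≤ A)
    (hB : ∀ α : List (Fin n), α.length ≤ γ.length → ‖iterPd2 α β σ x ξ‖ ≤ B) :
    ‖iterPd2 γ β (mulX f σ) x ξ‖ ≤ 2 ^ γ.length * (A * B) := by
  rw [iterPd2_mulX hO h γ β x hξ]
  refine norm_iterPd_mul_le isOpen_univ hf.contDiffOn (contDiff_slice h hO β hξ).contDiffOn γ
    (mem_univ x) hA fun α hα => ?_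
  rw [← iterPd2_apply]
  exact hB α hα

lemma iterPd2_tensor {f : Pt n → ℂ} {σ : Fun1 n} {O : Set (Pt n)} (hO : IsOpen O)
    (hf : ContDiff ℝ ∞ f) (hσ : ContDiffOn ℝ ∞ σ O) (γ β : List (Fin n)) (x : Pt n) {ξ : Pt n}
    (hξ : ξ ∈ O) : iterPd2 γ β (tensor f σ) x ξ = iterPd γ f x * iterPd β σ ξ := by
  rw [iterPd2_apply]
  have : (fun y => iterPd β (tensor f σ y) ξ) = fun y => iterPd β σ ξ * f y := by
    funext y
    rw [mul_comm]
    exact iterPd_const_mul hO hσ (f y) β hξ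
  rw [this, iterPd_const_mul isOpen_univ hf.contDiffOn _ γ (mem_univ x), mul_comm]

/-! ### Test functions -/

lemma hasCompactSupport_pd {f : Fun1 n} (h : HasCompactSupport f) (i : Fin n) :
    HasCompactSupport (pd i f) :=
  (h.fderiv (𝕜 := ℝ)).comp_left (g := fun L : Pt n →L[ℝ] ℂ => L (basisVec i)) (by simp)

lemma tsupport_pd_subset (f : Fun1 n) (i : Fin n) : tsupport (pd i f) ⊆ tsupport f := by
  refine (closure_mono fun x hx => ?_).trans (tsupport_fderiv_subset ℝ)
  intro h0
  exact hx (by simp [pd, h0])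

lemma pd_mem_testFun {U : Set (Pt n)} {f : Pt n → ℂ} (hf : f ∈ TestFun U) (i : Fin n) :
    pd i f ∈ TestFun U :=
  ⟨contDiff_pd hf.1 i, hasCompactSupport_pd hf.2.1 i, (tsupport_pd_subset f i).trans hf.2.2⟩

lemma hasCompactSupport_iterPd {f : Fun1 n} (h : HasCompactSupport f) (β : List (Fin n)) :
    HasCompactSupport (iterPd β f) := by
  induction β with
  | nil => exact h
  | cons i β ih => exact hasCompactSupport_pd ih i

lemma finite_words (m : ℕ) : {β : List (Fin n) | β.length ≤ m}.Finite :=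
  List.finite_length_le (Fin n) m

lemma exists_bound_iterPd {f : Fun1 n} (h : ∀ β, ∃ C : ℝ, ∀ x, ‖iterPd β f x‖ ≤ C) (m : ℕ) :
    ∃ C : ℝ, 0 < C ∧ ∀ β : List (Fin n), β.length ≤ m → ∀ x, ‖iterPd β f x‖ ≤ C := by
  choose C hC using h
  obtain ⟨M, hM⟩ := ((finite_words (n := n) m).image C).bddAbove
  refine ⟨max M 1, by positivity, fun β hβ x => ?_⟩
  exact (hC β x).trans ((hM ⟨β, hβ, rfl⟩).trans (le_max_left _ _))

lemma exists_bound_of_hasCompactSupport {f : Fun1 n} (hf : ContDiff ℝ ∞ f)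
    (h : HasCompactSupport f) (β : List (Fin n)) : ∃ C : ℝ, ∀ x, ‖iterPd β f x‖ ≤ C :=
  (hasCompactSupport_iterPd h β).exists_bound_of_continuous (contDiff_iterPd hf β).continuous

lemma add_mem_testFun {U : Set (Pt n)} {f g : Pt n → ℂ} (hf : f ∈ TestFun U)
    (hg : g ∈ TestFun U) : f + g ∈ TestFun U :=
  ⟨hf.1.add hg.1, hf.2.1.add hg.2.1,
    (tsupport_add f g).trans (union_subset hf.2.2 hg.2.2)⟩

lemma smul_mem_testFun {U : Set (Pt n)} {f : Pt n → ℂ} (hf : f ∈ TestFun U) (c : ℂ) :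
    c • f ∈ TestFun U :=
  ⟨contDiff_const.smul hf.1, hf.2.1.smul_left (f := fun _ => c),
    (tsupport_smul_subset_right (fun _ => c) f).trans hf.2.2⟩

lemma mul_mem_testFun {U : Set (Pt n)} {f g : Pt n → ℂ} (hf : f ∈ TestFun U)
    (hg : ContDiff ℝ ∞ g) : (fun x => g x * f x) ∈ TestFun U :=
  ⟨hg.mul hf.1, hf.2.1.mul_left (f := g),
    (tsupport_smul_subset_right g f).trans hf.2.2⟩

/-- Two intermediate compact sets are used, so that the value `1` is taken on a whole neighbourhood
of `K`; `testFun_split` needs this to control a support. -/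
lemma exists_testFun_eq_one {K U : Set (Pt n)} (hK : IsCompact K) (hU : IsOpen U) (hKU : K ⊆ U) :
    ∃ ψ ∈ TestFun U, ∃ V, IsOpen V ∧ K ⊆ V ∧ ∀ x ∈ V, ψ x = 1 := by
  obtain ⟨L, hL, hKL, hLU⟩ := exists_compact_between hK hU hKU
  obtain ⟨L', hL', hLL', hLU'⟩ := exists_compact_between hL hU hLU
  obtain ⟨φ, hφ0, hφ1, -⟩ := exists_contMDiffMap_zero_one_of_isClosed (n := ⊤)
    (modelWithCornersSelf ℝ (Pt n))
    (s := (interior L')ᶜ) (t := L) isOpen_interior.isClosed_compl hL.isClosed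
    (disjoint_compl_left_iff_subset.2 hLL')
  have hsupp : tsupport (fun x => (φ x : ℂ)) ⊆ L' := by
    refine closure_minimal (fun x hx => ?_) hL'.isClosed
    by_contra hxL
    exact hx (by simp [hφ0 fun h => hxL (interior_subset h)])
  refine ⟨fun x => (φ x : ℂ), ⟨?_, HasCompactSupport.of_support_subset_isCompact hL'
    (subset_closure.trans hsupp), hsupp.trans hLU'⟩, interior L, isOpen_interior, hKL,
    fun x hx => by simp [hφ1 (interior_subset hx)]⟩
  exact Complex.ofRealCLM.contDiff.comp φ.contMDiff.contDiff

/-! ### Uniqueness of finite parts -/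

lemma eq_zero_of_tendsto_affine {b c : ℂ}
    (h : Tendsto (fun t : ℝ => b * (t : ℂ) + c) atTop (𝓝 0)) : b = 0 ∧ c = 0 := by
  have h1 : Tendsto (fun t : ℝ => b * ((t + 1 : ℝ) : ℂ) + c) atTop (𝓝 0) :=
    h.comp (tendsto_atTop_add_const_right atTop (1 : ℝ) tendsto_id)
  have h2 : Tendsto (fun _ : ℝ => b) atTop (𝓝 0) := by
    refine (by simpa using h1.sub h : Tendsto _ _ (𝓝 (0 : ℂ))).congr fun t => ?_
    ring
  have hb : b = 0 := tendsto_nhds_unique tendsto_const_nhds h2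
  refine ⟨hb, ?_⟩
  simp only [hb, zero_mul, zero_add] at h
  exact tendsto_nhds_unique tendsto_const_nhds h

lemma exists_exp_ne_one {z : ℂ} (hz : z ≠ 0) : ∃ h : ℝ, Complex.exp (z * h) ≠ 1 := by
  by_contra! H
  have h1 : HasDerivAt (fun h : ℝ => Complex.exp (z * h)) (Complex.exp (z * (0 : ℝ)) * (z * 1)) 0 :=
    (((hasDerivAt_id (0 : ℝ)).ofReal_comp).const_mul z).cexp
  have h2 : HasDerivAt (fun h : ℝ => Complex.exp (z * h)) 0 0 := by
    simp_rw [H]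
    exact hasDerivAt_const _ _
  have := h1.unique h2
  simp at this
  exact hz this

/-- Growth rates cannot separate the terms, since exponents may share their real part. Instead
`F(t+s) - e^{ws} F(t)` removes the exponent `w`, keeps the shape of the other terms and multiplies
the slope `b` by `1 - e^{ws}`, which is non-zero for a suitable `s`. -/
lemma eq_zero_of_tendsto_expSum (Z : Finset ℂ) (hZ : (0 : ℂ) ∉ Z) (k : ℂ → ℂ) (b c : ℂ)
    (h : Tendsto (fun t : ℝ => ∑ z ∈ Z, k z * Complex.exp (z * t) + (b * t + c)) atTop (𝓝 0)) :
    b = 0 ∧ c = 0 := by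
  induction Z using Finset.induction_on generalizing k b c with
  | empty => simpa using eq_zero_of_tendsto_affine (by simpa using h)
  | insert w Z hw ih =>
    have hw0 : w ≠ 0 := fun h0 => hZ (by simp [h0])
    obtain ⟨s, hs⟩ := exists_exp_ne_one hw0
    have h1 := h.comp (tendsto_atTop_add_const_right atTop s tendsto_id)
    have h2 := h1.sub (h.const_mul (Complex.exp (w * s)))
    simp only [mul_zero, sub_zero] at h2
    obtain ⟨hb, hc⟩ := ih (fun h0 => hZ (Finset.mem_insert_of_mem h0))
      (fun z => k z * (Complex.exp (z * s) - Complex.exp (w * s)))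
      (b * (1 - Complex.exp (w * s))) (b * s + c * (1 - Complex.exp (w * s))) (by
        refine h2.congr fun t => ?_
        simp only [Function.comp_def, id, Finset.sum_insert hw, mul_add, Finset.mul_sum]
        push_cast
        simp only [mul_add, Complex.exp_add]
        have e : ∑ z ∈ Z, k z * (Complex.exp (z * s) - Complex.exp (w * s)) * Complex.exp (z * t)
            = ∑ z ∈ Z, k z * (Complex.exp (z * t) * Complex.exp (z * s))
              - ∑ z ∈ Z, Complex.exp (w * s) * (k z * Complex.exp (z * t)) := by
          rw [← Finset.sum_sub_distrib]
          exact Finset.sum_congr rfl fun z _ => by ring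
        rw [e]
        ring)
    have h3 : 1 - Complex.exp (w * s) ≠ 0 := sub_ne_zero.2 hs.symm
    have hb' : b = 0 := (mul_eq_zero.1 hb).resolve_right h3
    refine ⟨hb', ?_⟩
    rw [hb', zero_mul, zero_add] at hc
    exact (mul_eq_zero.1 hc).resolve_right h3

/-! ### Calculus of finite parts and of cut-off integrals -/

lemma HasFinitePart.add {F G : ℝ → ℂ} {c d : ℂ} (hF : HasFinitePart F c)
    (hG : HasFinitePart G d) : HasFinitePart (fun R => F R + G R) (c + d) := by
  classical
  obtain ⟨Z, k, b, hZ, h⟩ := hF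
  obtain ⟨Z', k', b', hZ', h'⟩ := hG
  refine ⟨Z ∪ Z', fun z => (if z ∈ Z then k z else 0) + (if z ∈ Z' then k' z else 0), b + b',
    by simp [hZ, hZ'], (h.add h').congr fun R => ?_⟩
  have e1 : ∑ z ∈ Z ∪ Z', (if z ∈ Z then k z else 0) * (R : ℂ) ^ z = ∑ z ∈ Z, k z * (R : ℂ) ^ z := by
    simp only [ite_mul, zero_mul]
    rw [Finset.sum_ite_mem, Finset.inter_eq_right.2 Finset.subset_union_left]
  have e2 : ∑ z ∈ Z ∪ Z', (if z ∈ Z' then k' z else 0) * (R : ℂ) ^ z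
      = ∑ z ∈ Z', k' z * (R : ℂ) ^ z := by
    simp only [ite_mul, zero_mul]
    rw [Finset.sum_ite_mem, Finset.inter_eq_right.2 Finset.subset_union_right]
  simp only [add_mul, Finset.sum_add_distrib, e1, e2]
  ring

lemma HasFinitePart.const_mul {F : ℝ → ℂ} {c : ℂ} (hF : HasFinitePart F c) (a : ℂ) :
    HasFinitePart (fun R => a * F R) (a * c) := by
  obtain ⟨Z, k, b, hZ, h⟩ := hF
  refine ⟨Z, fun z => a * k z, a * b, hZ, (h.const_mul a).congr fun R => ?_⟩
  simp only [mul_assoc, ← Finset.mul_sum]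
  ring

lemma HasFinitePart.of_tendsto {F : ℝ → ℂ} {c : ℂ} (h : Tendsto F atTop (𝓝 c)) :
    HasFinitePart F c := ⟨∅, 0, 0, by simp, by simpa using h⟩

lemma HasFinitePart.congr {F G : ℝ → ℂ} {c : ℂ} (hF : HasFinitePart F c) (h : F =ᶠ[atTop] G) :
    HasFinitePart G c := by
  obtain ⟨Z, k, b, hZ, hh⟩ := hF
  refine ⟨Z, k, b, hZ, hh.congr' ?_⟩
  filter_upwards [h] with R hR
  rw [hR]

/-- The substitution `R = e^t` turns powers into exponentials and `log R` into `t`. -/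
lemma HasFinitePart.eq_zero {c : ℂ} (h : HasFinitePart (fun _ => 0) c) : c = 0 := by
  obtain ⟨Z, k, b, hZ, h⟩ := h
  have h1 := (h.comp Real.tendsto_exp_atTop).sub_const c
  rw [sub_self] at h1
  have := (eq_zero_of_tendsto_expSum Z hZ (fun z => -k z) (-b) (-c) (h1.congr fun t => ?_)).2
  · simpa using this
  · simp only [Function.comp_def, Real.log_exp, zero_sub, neg_mul, Finset.sum_neg_distrib]
    have : ∀ z : ℂ, ((Real.exp t : ℝ) : ℂ) ^ z = Complex.exp (z * t) := fun z => by
      rw [Complex.cpow_def_of_ne_zero (by exact_mod_cast (Real.exp_pos t).ne'),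
        ← Complex.ofReal_log (Real.exp_pos t).le, Real.log_exp, mul_comm]
    simp only [this]
    ring

lemma HasFinitePart.unique {F : ℝ → ℂ} {c d : ℂ} (h : HasFinitePart F c)
    (h' : HasFinitePart F d) : c = d := by
  have := (h.add (h'.const_mul (-1))).congr (G := fun _ => 0) (.of_forall fun R => by ring)
  have := this.eq_zero
  linear_combination this

/-- `c` is the finite part of the integrals of `σ` over large balls, on which `σ` is integrable. -/
def HasCutoffIntegral (σ : Fun1 n) (c : ℂ) : Prop :=
  (∀ R, IntegrableOn σ (Metric.ball 0 R)) ∧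
    HasFinitePart (fun R => ∫ ξ in Metric.ball (0 : Pt n) R, σ ξ) c

lemma HasCutoffIntegral.eq {σ : Fun1 n} {c : ℂ} (h : HasCutoffIntegral σ c) :
    cutoffIntegral σ = c := by
  have h' : ∃ c, HasFinitePart (fun R => ∫ ξ in Metric.ball (0 : Pt n) R, σ ξ) c := ⟨c, h.2⟩
  rw [cutoffIntegral, dif_pos h']
  exact h'.choose_spec.unique h.2

lemma HasCutoffIntegral.add {σ τ : Fun1 n} {c d : ℂ} (h : HasCutoffIntegral σ c)
    (h' : HasCutoffIntegral τ d) : HasCutoffIntegral (σ + τ) (c + d) :=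
  ⟨fun R => (h.1 R).add (h'.1 R), (h.2.add h'.2).congr
    (.of_forall fun R => (integral_add (h.1 R) (h'.1 R)).symm)⟩

lemma HasCutoffIntegral.smul {σ : Fun1 n} {c : ℂ} (h : HasCutoffIntegral σ c) (a : ℂ) :
    HasCutoffIntegral (a • σ) (a * c) :=
  ⟨fun R => (h.1 R).smul a, (h.2.const_mul a).congr
    (.of_forall fun _ => (integral_const_mul a _).symm)⟩

lemma HasCutoffIntegral.zero : HasCutoffIntegral (0 : Fun1 n) 0 :=
  ⟨fun _ => integrableOn_zero, .of_tendsto (by simp)⟩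

lemma HasCutoffIntegral.sum {ι : Type*} (s : Finset ι) {σ : ι → Fun1 n} {c : ι → ℂ}
    (h : ∀ i ∈ s, HasCutoffIntegral (σ i) (c i)) :
    HasCutoffIntegral (∑ i ∈ s, σ i) (∑ i ∈ s, c i) := by
  classical
  induction s using Finset.induction_on with
  | empty => simpa using HasCutoffIntegral.zero
  | insert i s hi ih =>
    rw [Finset.sum_insert hi, Finset.sum_insert hi]
    exact (h i (by simp)).add (ih fun j hj => h j (by simp [hj]))

lemma HasCutoffIntegral.of_integrable {σ : Fun1 n} (h : Integrable σ) :
    HasCutoffIntegral σ (∫ ξ, σ ξ) := by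
  refine ⟨fun R => h.integrableOn, .of_tendsto ?_⟩
  have hm : Monotone fun R : ℝ => Metric.ball (0 : Pt n) R := fun _ _ h => Metric.ball_subset_ball h
  have hU : ⋃ R : ℝ, Metric.ball (0 : Pt n) R = univ :=
    eq_univ_of_forall fun x => mem_iUnion.2 ⟨‖x‖ + 1, by simp⟩
  have := tendsto_setIntegral_of_monotone (μ := volume) (f := σ)
    (fun R : ℝ => Metric.isOpen_ball.measurableSet) hm h.integrableOn
  rwa [hU, setIntegral_univ] at this

/-! ### Homogeneous functions in polar coordinates -/

lemma integral_norm_mul_normalized [NeZero n] (g : ℝ → ℂ) (h : Fun1 n) :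
    ∫ x : Pt n, g ‖x‖ * h (‖x‖⁻¹ • x) =
      sphereIntegral h * ∫ y in Ioi (0 : ℝ), (y : ℂ) ^ (n - 1) * g y := by
  have hdim : Module.finrank ℝ (Pt n) = n := by simp
  calc
    ∫ x : Pt n, g ‖x‖ * h (‖x‖⁻¹ • x)
      = ∫ x : ({(0)}ᶜ : Set (Pt n)), g ‖x.1‖ * h (‖x.1‖⁻¹ • x.1)
          ∂((volume : Measure (Pt n)).comap (↑)) := by
      rw [integral_subtype_comap (measurableSet_singleton _).compl
        fun x : Pt n ↦ g ‖x‖ * h (‖x‖⁻¹ • x), restrict_compl_singleton]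
    _ = ∫ x, h x.1 * g x.2 ∂(volume : Measure (Pt n)).toSphere.prod (.volumeIoiPow (n - 1)) := by
      have e : Measure.volumeIoiPow (n - 1)
          = Measure.volumeIoiPow (Module.finrank ℝ (Pt n) - 1) := by rw [hdim]
      rw [e, ← (volume : Measure (Pt n)).measurePreserving_homeomorphUnitSphereProd.integral_comp
        (Homeomorph.measurableEmbedding _) (fun x => h x.1 * g x.2)]
      congr 1
      funext x
      simp [mul_comm]
    _ = sphereIntegral h * ∫ x : Ioi (0 : ℝ), g x ∂.volumeIoiPow (n - 1) :=
      integral_prod_mul (fun x : Metric.sphere (0 : Pt n) 1 => h x) (fun y : Ioi (0 : ℝ) => g y)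
    _ = _ := by
      simp only [Measure.volumeIoiPow, ENNReal.ofReal]
      rw [integral_withDensity_eq_integral_smul,
        integral_subtype_comap measurableSet_Ioi fun a ↦ Real.toNNReal (a ^ (n - 1)) • g a,
        setIntegral_congr_fun measurableSet_Ioi fun x hx ↦ ?_]
      · rw [NNReal.smul_def, Real.coe_toNNReal _ (pow_nonneg hx.out.le _)]
        simp
      · exact (measurable_subtype_coe.pow_const _).real_toNNReal

/-- The cut-off vanishes near the origin, the only place where `f` may be singular. -/
lemma contDiff_cutoff_mul {χ : Pt n → ℝ} (hχ : IsCutoff χ) {k : ℕ∞ω} (hk : k ≤ ∞) {f : Fun1 n}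
    (hf : ContDiffOn ℝ k f {0}ᶜ) : ContDiff ℝ k (fun ξ => (χ ξ : ℂ) * f ξ) := by
  obtain ⟨h1, ⟨r, hr, h0⟩, -⟩ := hχ
  rw [contDiff_iff_contDiffAt]
  intro x
  by_cases hx : x = 0
  · subst hx
    refine (contDiffAt_const (c := (0 : ℂ))).congr_of_eventuallyEq ?_
    filter_upwards [Metric.ball_mem_nhds (0 : Pt n) hr] with y hy
    simp [h0 y (by simpa using hy)]
  · exact (Complex.ofRealCLM.contDiff.comp (h1.of_le hk)).contDiffAt.mul
      (hf.contDiffAt (isOpen_compl_singleton.mem_nhds hx))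

lemma continuous_cutoff_mul {χ : Pt n → ℝ} (hχ : IsCutoff χ) {f : Fun1 n}
    (hf : ContinuousOn f {0}ᶜ) : Continuous (fun ξ => (χ ξ : ℂ) * f ξ) :=
  contDiff_zero.1 (contDiff_cutoff_mul hχ (by simp) (contDiffOn_zero.2 hf))

lemma integrableOn_ball_of_continuous {f : Fun1 n} (hf : Continuous f) (R : ℝ) :
    IntegrableOn f (Metric.ball 0 R) :=
  (hf.continuousOn.integrableOn_compact (isCompact_closedBall 0 R)).mono_set
    Metric.ball_subset_closedBall

lemma eq_norm_cpow_mul {w : ℂ} {s : Fun1 n}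
    (hom : ∀ ξ, ξ ≠ 0 → ∀ t : ℝ, 0 < t → s (t • ξ) = (t : ℂ) ^ w * s ξ) {ξ : Pt n} (hξ : ξ ≠ 0) :
    s ξ = (‖ξ‖ : ℂ) ^ w * s (‖ξ‖⁻¹ • ξ) := by
  have h := norm_pos_iff.2 hξ
  have := hom (‖ξ‖⁻¹ • ξ) (by simp [hξ]) ‖ξ‖ h
  rwa [smul_smul, mul_inv_cancel₀ h.ne', one_smul] at this

lemma setIntegral_annulus_of_homogeneous [NeZero n] {w : ℂ} {s : Fun1 n}
    (hom : ∀ ξ, ξ ≠ 0 → ∀ t : ℝ, 0 < t → s (t • ξ) = (t : ℂ) ^ w * s ξ) {R : ℝ} (hR : 1 ≤ R) :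
    ∫ ξ in Metric.ball (0 : Pt n) R \ Metric.ball 0 1, s ξ
      = sphereIntegral s * ∫ y : ℝ in (1 : ℝ)..R, (y : ℂ) ^ (w + n - 1) := by
  rw [← integral_indicator (Metric.isOpen_ball.measurableSet.diff Metric.isOpen_ball.measurableSet)]
  have h1 : (Metric.ball (0 : Pt n) R \ Metric.ball 0 1).indicator s = fun ξ =>
      (Ico 1 R).indicator (fun y : ℝ => (y : ℂ) ^ w) ‖ξ‖ * s (‖ξ‖⁻¹ • ξ) := by
    funext ξ
    by_cases h : ξ ∈ Metric.ball (0 : Pt n) R \ Metric.ball 0 1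
    · have h' : ‖ξ‖ ∈ Ico 1 R := by simpa [and_comm] using h
      rw [indicator_of_mem h, indicator_of_mem h']
      exact eq_norm_cpow_mul hom (norm_pos_iff.1 (by linarith [h'.1]))
    · have h' : ‖ξ‖ ∉ Ico 1 R := by simpa [and_comm] using h
      rw [indicator_of_notMem h, indicator_of_notMem h', zero_mul]
  rw [h1, integral_norm_mul_normalized]
  congr 1
  have h2 : (fun y : ℝ => (y : ℂ) ^ (n - 1) * (Ico 1 R).indicator (fun y : ℝ => (y : ℂ) ^ w) y)
      = (Ico 1 R).indicator fun y : ℝ => (y : ℂ) ^ (w + n - 1) := by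
    funext y
    by_cases hy : y ∈ Ico 1 R
    · rw [indicator_of_mem hy, indicator_of_mem hy]
      have hy0 : (y : ℂ) ≠ 0 := by exact_mod_cast (by linarith [hy.1] : y ≠ 0)
      rw [← Complex.cpow_natCast, ← Complex.cpow_add _ _ hy0, Nat.cast_sub NeZero.one_le]
      congr 1
      push_cast
      ring
    · rw [indicator_of_notMem hy, indicator_of_notMem hy, mul_zero]
  rw [h2, setIntegral_indicator measurableSet_Ico, intervalIntegral.integral_of_le hR,
    ← integral_Ico_eq_integral_Ioc]
  congr 2
  exact inter_eq_right.2 fun y hy => lt_of_lt_of_le one_pos hy.1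

lemma exists_hasFinitePart_radial (z : ℂ) :
    ∃ c, HasFinitePart (fun R => ∫ y : ℝ in (1 : ℝ)..R, (y : ℂ) ^ (z - 1)) c := by
  by_cases hz : z = 0
  -- Here the integral is exactly `log R`, whose constant term is `0`.
  · refine ⟨0, ∅, 0, 1, by simp, tendsto_const_nhds.congr' ?_⟩
    filter_upwards [eventually_ge_atTop (1 : ℝ)] with R hR
    have : ∫ y : ℝ in (1 : ℝ)..R, (y : ℂ) ^ (z - 1) = ∫ y : ℝ in (1 : ℝ)..R, ((y⁻¹ : ℝ) : ℂ) := by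
      refine intervalIntegral.integral_congr fun y _ => ?_
      simp [hz, Complex.cpow_neg_one]
    rw [this, intervalIntegral.integral_ofReal, integral_inv_of_pos one_pos (by linarith)]
    simp
  -- Here the integral is `(R^z - 1) / z`.
  · refine ⟨-1 / z, {z}, fun _ => 1 / z, 0, by simpa using Ne.symm hz, tendsto_const_nhds.congr' ?_⟩
    filter_upwards [eventually_ge_atTop (1 : ℝ)] with R hR
    rw [integral_cpow (Or.inr ⟨fun h => hz (by linear_combination h), fun h => ?_⟩)]
    · simp
      ring
    · rw [uIcc_of_le hR] at h
      linarith [h.1]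

lemma norm_sphereIntegral_le {s : Fun1 n} {ε : ℝ} (h : ∀ ξ, ‖ξ‖ = 1 → ‖s ξ‖ ≤ ε) :
    ‖sphereIntegral s‖ ≤ (volume : Measure (Pt n)).toSphere.real univ * ε := by
  refine (norm_integral_le_of_norm_le_const (μ := (volume : Measure (Pt n)).toSphere)
    (f := fun θ : Metric.sphere (0 : Pt n) 1 => s θ) (C := ε) (.of_forall fun θ => h θ ?_)).trans_eq
    (mul_comm _ _)
  simp

/-- A large ball is the unit ball and an annulus on which `χ = 1`; the annulus contributes the
spherical integral times a radial one. The constant depends on `χ` and `w` only, and this linear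
bound by the supremum on the sphere is the continuity used later. -/
lemma exists_cutoffIntegral_homogeneous [NeZero n] {χ : Pt n → ℝ} (hχ : IsCutoff χ) (w : ℂ) :
    ∃ C : ℝ, ∀ s : Fun1 n, ContinuousOn s {0}ᶜ →
      (∀ ξ, ξ ≠ 0 → ∀ t : ℝ, 0 < t → s (t • ξ) = (t : ℂ) ^ w * s ξ) →
      ∀ ε : ℝ, (∀ ξ, ‖ξ‖ = 1 → ‖s ξ‖ ≤ ε) →
        ∃ c, HasCutoffIntegral (fun ξ => (χ ξ : ℂ) * s ξ) c ∧ ‖c‖ ≤ C * ε := by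
  -- `χ(ξ) |ξ|^w` is continuous even when `|ξ|^w` blows up at `0`, so `M` does not depend on `s`.
  obtain ⟨M, hM⟩ := (isCompact_closedBall (0 : Pt n) 1).exists_bound_of_continuousOn
    (continuous_cutoff_mul hχ (f := fun ξ => (‖ξ‖ : ℂ) ^ w) (by
      intro ξ hξ
      refine ContinuousAt.continuousWithinAt ?_
      refine ContinuousAt.cpow (by fun_prop) continuousAt_const (Or.inl ?_)
      simpa using hξ)).continuousOn
  obtain ⟨c, hc⟩ := exists_hasFinitePart_radial (w + n)
  refine ⟨M * volume.real (Metric.ball (0 : Pt n) 1)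
    + (volume : Measure (Pt n)).toSphere.real univ * ‖c‖, fun s hs hom ε hε => ?_⟩
  have hcont := continuous_cutoff_mul hχ hs
  have hint := integrableOn_ball_of_continuous hcont
  refine ⟨(∫ ξ in Metric.ball (0 : Pt n) 1, (χ ξ : ℂ) * s ξ) + sphereIntegral s * c,
    ⟨hint, ?_⟩, ?_⟩
  · refine ((HasFinitePart.of_tendsto tendsto_const_nhds).add
      (hc.const_mul (sphereIntegral s))).congr ?_
    filter_upwards [eventually_ge_atTop (1 : ℝ)] with R hR
    rw [← setIntegral_annulus_of_homogeneous hom hR]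
    have hsub : Metric.ball (0 : Pt n) 1 ⊆ Metric.ball 0 R := Metric.ball_subset_ball hR
    have h1 : ∫ ξ in Metric.ball (0 : Pt n) R \ Metric.ball 0 1, s ξ
        = ∫ ξ in Metric.ball (0 : Pt n) R \ Metric.ball 0 1, (χ ξ : ℂ) * s ξ := by
      refine setIntegral_congr_fun
        (Metric.isOpen_ball.measurableSet.diff Metric.isOpen_ball.measurableSet) fun ξ hξ => ?_
      simp [hχ.2.2 ξ (by simpa using hξ.2)]
    rw [h1, ← setIntegral_union disjoint_sdiff_right
      (Metric.isOpen_ball.measurableSet.diff Metric.isOpen_ball.measurableSet) (hint 1)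
      ((hint R).mono_set sdiff_subset), union_sdiff_cancel hsub]
  · have h1 : ‖∫ ξ in Metric.ball (0 : Pt n) 1, (χ ξ : ℂ) * s ξ‖
        ≤ M * ε * volume.real (Metric.ball (0 : Pt n) 1) := by
      refine norm_setIntegral_le_of_norm_le_const measure_ball_lt_top fun ξ hξ => ?_
      by_cases h0 : ξ = 0
      · obtain ⟨r, hr, h⟩ := hχ.2.1
        have hM0 := (norm_nonneg _).trans (hM 0 (by simp))
        -- A unit vector exists because `n ≠ 0`; the bound there forces `ε ≥ 0`.
        obtain ⟨e⟩ : Nonempty (Fin n) := ⟨0⟩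
        have hε0 := (norm_nonneg _).trans (hε (basisVec e) (by simp [basisVec]))
        simp only [h0, h 0 (by simpa using hr)]
        simpa using mul_nonneg hM0 hε0
      · rw [eq_norm_cpow_mul hom h0, ← mul_assoc, norm_mul]
        refine mul_le_mul (hM ξ (Metric.ball_subset_closedBall hξ)) (hε _ ?_) (norm_nonneg _)
          ((norm_nonneg _).trans (hM ξ (Metric.ball_subset_closedBall hξ)))
        simp [norm_smul, h0]
    have h2 := norm_sphereIntegral_le hε
    calc _ ≤ _ := norm_add_le _ _
      _ ≤ M * ε * volume.real (Metric.ball (0 : Pt n) 1)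
          + ((volume : Measure (Pt n)).toSphere.real univ * ε) * ‖c‖ := by
        rw [norm_mul]
        gcongr
      _ = _ := by ring

/-- The cut-off integral exists on the classical symbols of order `a`, and is continuous there. -/
lemma exists_cutoffIntegral_bound [NeZero n] {χ : Pt n → ℝ} (hχ : IsCutoff χ) (a : ℂ) :
    ∃ (m : ℕ) (C : ℝ), ∀ (σ : Fun1 n) (s : ℕ → Fun1 n),
      (∀ j, ContinuousOn (s j) {0}ᶜ) →
      (∀ j, ∀ ξ, ξ ≠ 0 → ∀ t : ℝ, 0 < t → s j (t • ξ) = (t : ℂ) ^ (a - j) * s j ξ) →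
      Continuous (fun ξ => σ ξ - ∑ j ∈ Finset.range m, (χ ξ : ℂ) * s j ξ) →
      ∀ ε : ℝ, (∀ ξ, ‖σ ξ - ∑ j ∈ Finset.range m, (χ ξ : ℂ) * s j ξ‖
        ≤ ε * (1 + ‖ξ‖) ^ (a.re - m)) → (∀ j < m, ∀ ξ, ‖ξ‖ = 1 → ‖s j ξ‖ ≤ ε) →
      ∃ c, HasCutoffIntegral σ c ∧ ‖c‖ ≤ C * ε := by
  -- Beyond `Re a + n` terms the remainder decays faster than `|ξ|^{-n}`, hence is integrable.
  obtain ⟨m, hm⟩ := exists_nat_gt (a.re + n)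
  have hI : Integrable (fun ξ : Pt n => (1 + ‖ξ‖) ^ (a.re - m)) := by
    have := integrable_one_add_norm (E := Pt n) (μ := volume) (r := m - a.re)
      (by simp; linarith)
    simpa using this
  choose C hC using fun j : ℕ => exists_cutoffIntegral_homogeneous hχ (a - j)
  refine ⟨m, (∫ ξ : Pt n, (1 + ‖ξ‖) ^ (a.re - m)) + ∑ j ∈ Finset.range m, C j,
    fun σ s hs hom hc ε h1 h2 => ?_⟩
  have hint : Integrable (fun ξ => σ ξ - ∑ j ∈ Finset.range m, (χ ξ : ℂ) * s j ξ) :=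
    (hI.const_mul ε).mono' hc.aestronglyMeasurable (.of_forall h1)
  have hj : ∀ j, ∃ c, j < m → HasCutoffIntegral (fun ξ => (χ ξ : ℂ) * s j ξ) c ∧
      ‖c‖ ≤ C j * ε := fun j => by
    by_cases hjm : j < m
    · obtain ⟨c, hc⟩ := hC j (s j) (hs j) (hom j) ε (h2 j hjm)
      exact ⟨c, fun _ => hc⟩
    · exact ⟨0, fun h => absurd h hjm⟩
  choose c hc using hj
  refine ⟨(∫ ξ, (σ ξ - ∑ j ∈ Finset.range m, (χ ξ : ℂ) * s j ξ)) + ∑ j ∈ Finset.range m, c j,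
    ?_, ?_⟩
  · convert (HasCutoffIntegral.of_integrable hint).add (HasCutoffIntegral.sum (Finset.range m)
      (σ := fun j ξ => (χ ξ : ℂ) * s j ξ) (c := c) fun j hj => (hc j (Finset.mem_range.1 hj)).1)
      using 1
    funext ξ
    simp
  · rw [add_mul, Finset.sum_mul]
    refine (norm_add_le _ _).trans (add_le_add ?_ ((norm_sum_le _ _).trans
      (Finset.sum_le_sum fun j hj => (hc j (Finset.mem_range.1 hj)).2)))
    rw [mul_comm, ← integral_const_mul]
    exact norm_integral_le_of_norm_le (hI.const_mul ε) (.of_forall h1)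

lemma IsExpansionCC.exists_hasCutoffIntegral [NeZero n] {χ : Pt n → ℝ} (hχ : IsCutoff χ) {a : ℂ}
    {σ : Fun1 n} {s : ℕ → Fun1 n} (h : IsExpansionCC χ a σ s) : ∃ c, HasCutoffIntegral σ c := by
  obtain ⟨m, C, H⟩ := exists_cutoffIntegral_bound hχ a
  obtain ⟨h1, h2, h3⟩ := h
  obtain ⟨B, hB⟩ := (h3 m).2 []
  have : ∀ j, ∃ M, ∀ ξ : Pt n, ‖ξ‖ = 1 → ‖s j ξ‖ ≤ M := fun j => by
    obtain ⟨M, hM⟩ := (isCompact_sphere (0 : Pt n) 1).exists_bound_of_continuousOn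
      ((h1 j).continuousOn.mono fun ξ hξ h0 => by
        rw [mem_singleton_iff] at h0; simp [h0] at hξ)
    exact ⟨M, fun ξ hξ => hM ξ (by simpa using hξ)⟩
  choose M hM using this
  obtain ⟨M', hM'⟩ := ((Finset.range m).image M).bddAbove
  have hb : ∀ ξ, ‖σ ξ - ∑ j ∈ Finset.range m, (χ ξ : ℂ) * s j ξ‖
      ≤ max B M' * (1 + ‖ξ‖) ^ (a.re - m) := fun ξ => by
    have h4 := hB ξ
    simp only [iterPd, List.foldr_nil, List.length_nil, Nat.cast_zero, sub_zero] at h4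
    refine h4.trans ?_
    gcongr
    exact le_max_left _ _
  obtain ⟨c, hc, -⟩ := H σ s (fun j => (h1 j).continuousOn) h2 (h3 m).1.continuous _ hb
    fun j hj ξ hξ => (hM j ξ hξ).trans
      ((hM' (by simpa using ⟨j, hj, rfl⟩)).trans (le_max_right _ _))
  exact ⟨c, hc⟩

/-! ### Superpositions of translates -/

/-- The superposition of the translates of `f` by `v p` with weights `k p`. -/
def translates {X : Type*} [MeasurableSpace X] (ν : Measure X) (k : X → ℂ) (v : X → Pt n)
    (f : Fun1 n) : Fun1 n := fun x => ∫ p, k p * f (x - v p) ∂ν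

lemma integrable_translates {X : Type*} [MeasurableSpace X] {ν : Measure X} {k : X → ℂ}
    {v : X → Pt n} (hk : Integrable k ν) (hv : Measurable v) {f : Fun1 n} (hf : f ∈ TestFun univ)
    (x : Pt n) : Integrable (fun p => k p * f (x - v p)) ν := by
  obtain ⟨M, hM⟩ := hf.2.1.exists_bound_of_continuous hf.1.continuous
  exact hk.mul_bdd (c := M) (hf.1.continuous.comp_aestronglyMeasurable
    (measurable_const.sub hv).aestronglyMeasurable) (.of_forall fun p => hM _)

lemma hasFDerivAt_translates {X : Type*} [MeasurableSpace X] {ν : Measure X} {k : X → ℂ}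
    {v : X → Pt n} (hk : Integrable k ν) (hv : Measurable v) {f : Fun1 n} (hf : f ∈ TestFun univ)
    (x : Pt n) :
    Integrable (fun p => k p • fderiv ℝ f (x - v p)) ν ∧
    HasFDerivAt (translates ν k v f) (∫ p, k p • fderiv ℝ f (x - v p) ∂ν) x := by
  have hc : Continuous (fderiv ℝ f) := hf.1.continuous_fderiv (by simp)
  obtain ⟨M, hM⟩ := (hf.2.1.fderiv (𝕜 := ℝ)).exists_bound_of_continuous hc
  have hm : AEStronglyMeasurable (fun p => k p • fderiv ℝ f (x - v p)) ν :=
    hk.aestronglyMeasurable.smul (hc.comp_aestronglyMeasurable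
      (measurable_const.sub hv).aestronglyMeasurable)
  have hb : ∀ p y, ‖k p • fderiv ℝ f (y - v p)‖ ≤ ‖k p‖ * M := fun p y => by
    rw [norm_smul]
    gcongr
    exact hM _
  refine ⟨(hk.norm.mul_const M).mono' hm (.of_forall fun p => hb p x), ?_⟩
  refine hasFDerivAt_integral_of_dominated_of_fderiv_le (bound := fun p => ‖k p‖ * M)
    (F' := fun y p => k p • fderiv ℝ f (y - v p)) univ_mem
    (.of_forall fun y => (integrable_translates hk hv hf y).aestronglyMeasurable)
    (integrable_translates hk hv hf x) hm (.of_forall fun p y _ => hb p y)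
    (hk.norm.mul_const M) (.of_forall fun p y _ => ?_)
  have h1 : HasFDerivAt f (fderiv ℝ f (y - v p)) (y - v p) :=
    (hf.1.differentiable (by simp) _).hasFDerivAt
  have h2 := h1.comp y ((hasFDerivAt_id y).sub_const (v p))
  simpa using h2.const_mul (k p)

lemma pd_translates {X : Type*} [MeasurableSpace X] {ν : Measure X} {k : X → ℂ}
    {v : X → Pt n} (hk : Integrable k ν) (hv : Measurable v) {f : Fun1 n} (hf : f ∈ TestFun univ)
    (i : Fin n) : pd i (translates ν k v f) = translates ν k v (pd i f) := by
  funext x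
  obtain ⟨h1, h2⟩ := hasFDerivAt_translates hk hv hf x
  rw [pd, h2.fderiv, ContinuousLinearMap.integral_apply h1]
  rfl

lemma clm_apply_eq_sum (L : Pt n →L[ℝ] ℂ) (h : Pt n) :
    L h = ∑ i, (h i : ℂ) * L (basisVec i) := by
  have : h = ∑ i, h i • basisVec i := by
    ext j
    simp [basisVec, Pi.single_apply]
  conv_lhs => rw [this]
  simp

lemma contDiff_of_pd {f : Fun1 n} (hf : Differentiable ℝ f) {m : ℕ}
    (h : ∀ i, ContDiff ℝ m (pd i f)) : ContDiff ℝ (m + 1 : ℕ) f := by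
  have : fderiv ℝ f = fun x => ∑ i, (ContinuousLinearMap.smulRight
      (EuclideanSpace.proj i : Pt n →L[ℝ] ℝ) (pd i f x)) := by
    funext x
    ext h
    rw [clm_apply_eq_sum]
    simp [pd]
  push_cast
  rw [contDiff_succ_iff_fderiv]
  refine ⟨hf, by simp, ?_⟩
  rw [this]
  refine ContDiff.sum fun i _ => ?_
  exact contDiff_const.smulRight (h i)

/-- All derivatives fall on `f`, and `∂_i f` is again a test function, so smoothness climbs by
induction while the weight `k` need only be integrable. -/
lemma contDiff_translates {X : Type*} [MeasurableSpace X] {ν : Measure X} {k : X → ℂ}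
    {v : X → Pt n} (hk : Integrable k ν) (hv : Measurable v) {f : Fun1 n}
    (hf : f ∈ TestFun univ) : ContDiff ℝ ∞ (translates ν k v f) := by
  rw [contDiff_infty]
  intro m
  have hd : ∀ f ∈ TestFun univ, Differentiable ℝ (translates ν k v f) := fun f hf x =>
    (hasFDerivAt_translates hk hv hf x).2.differentiableAt
  induction m generalizing f with
  | zero => exact contDiff_zero.2 (hd f hf).continuous
  | succ m ih =>
    refine contDiff_of_pd (hd f hf) fun i => ?_
    rw [pd_translates hk hv hf]
    exact ih (pd_mem_testFun hf i)

lemma testFun_mono {U V : Set (Pt n)} (h : U ⊆ V) {f : Pt n → ℂ} (hf : f ∈ TestFun U) :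
    f ∈ TestFun V := ⟨hf.1, hf.2.1, hf.2.2.trans h⟩

/-- The primitives `G_i`, with `∑ ∂_i G_i = f ∫ φ - φ ∗ f`. -/
def prim (φ f : Fun1 n) (i : Fin n) : Fun1 n :=
  translates ((volume : Measure (Pt n)).prod ((volume : Measure ℝ).restrict (Icc 0 1)))
    (fun p => φ p.1 * (p.1 i : ℂ)) (fun p => p.2 • p.1) f

lemma integrable_prim_weight {φ : Fun1 n} (hφ : φ ∈ TestFun univ) (i : Fin n) :
    Integrable (fun p : Pt n × ℝ => φ p.1 * (p.1 i : ℂ))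
      ((volume : Measure (Pt n)).prod ((volume : Measure ℝ).restrict (Icc 0 1))) := by
  have : Integrable (fun h : Pt n => φ h * (h i : ℂ)) := by
    refine Continuous.integrable_of_hasCompactSupport ?_ (hφ.2.1.mul_right)
    exact hφ.1.continuous.mul (by fun_prop)
  exact this.comp_fst _

lemma measurable_smul_prod : Measurable (fun p : Pt n × ℝ => p.2 • p.1) :=
  (continuous_snd.smul continuous_fst).measurable

lemma integral_fderiv_segment {f : Fun1 n} (hf : ContDiff ℝ ∞ f) (x h : Pt n) :
    ∫ t in Icc (0 : ℝ) 1, fderiv ℝ f (x - t • h) h = f x - f (x - h) := by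
  rw [integral_Icc_eq_integral_Ioc, ← intervalIntegral.integral_of_le zero_le_one]
  have hd : ∀ t : ℝ, HasDerivAt (fun t : ℝ => -f (x - t • h)) (fderiv ℝ f (x - t • h) h) t := by
    intro t
    have h1 : HasFDerivAt f (fderiv ℝ f (x - t • h)) (x - t • h) :=
      (hf.differentiable (by simp) _).hasFDerivAt
    have h2 : HasDerivAt (fun t : ℝ => x - t • h) (-((1 : ℝ) • h)) t :=
      ((hasDerivAt_id t).smul_const h).const_sub x
    exact ((h1.comp_hasDerivAt t h2).neg).congr_deriv (by simp)
  rw [intervalIntegral.integral_eq_sub_of_hasDerivAt (fun t _ => hd t)]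
  · simp
    ring
  · refine Continuous.intervalIntegrable ?_ _ _
    have hc : Continuous (fderiv ℝ f) := hf.continuous_fderiv (by simp)
    exact (hc.comp (by fun_prop)).clm_apply continuous_const

/-- Write `f(x) - f(x-h) = ∫_0^1 Df(x-th) h dt`, expand `h` in the canonical basis and integrate
against `φ(h)`. -/
lemma sum_pd_prim {φ f : Fun1 n} (hφ : φ ∈ TestFun univ) (hf : f ∈ TestFun univ) (x : Pt n) :
    ∑ i, pd i (prim φ f i) x = f x * (∫ h, φ h) - ∫ h, φ h * f (x - h) := by
  have hint := fun i => integrable_translates (integrable_prim_weight hφ i)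
    measurable_smul_prod (pd_mem_testFun hf i) x
  have h1 : ∑ i, pd i (prim φ f i) x =
      ∫ p : Pt n × ℝ, φ p.1 * fderiv ℝ f (x - p.2 • p.1) p.1
        ∂((volume : Measure (Pt n)).prod ((volume : Measure ℝ).restrict (Icc 0 1))) := by
    simp only [prim, pd_translates (integrable_prim_weight hφ _) measurable_smul_prod hf]
    simp only [translates]
    rw [← integral_finsetSum _ fun i _ => hint i]
    congr 1
    funext p
    rw [clm_apply_eq_sum, Finset.mul_sum]
    simp [pd, mul_assoc]
  have h2 : Integrable (fun p : Pt n × ℝ => φ p.1 * fderiv ℝ f (x - p.2 • p.1) p.1)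
      ((volume : Measure (Pt n)).prod ((volume : Measure ℝ).restrict (Icc 0 1))) := by
    refine (integrable_finsetSum Finset.univ fun i _ => hint i).congr (.of_forall fun p => ?_)
    simp only
    rw [clm_apply_eq_sum (fderiv ℝ f (x - p.2 • p.1)), Finset.mul_sum]
    simp [pd, mul_assoc]
  rw [h1, integral_prod _ h2]
  simp only [integral_const_mul, integral_fderiv_segment hf.1, mul_sub]
  rw [integral_sub, integral_mul_const, mul_comm]
  · exact (hφ.1.continuous.integrable_of_hasCompactSupport hφ.2.1).mul_const _
  · simpa using integrable_translates (v := fun h => h)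
      (hφ.1.continuous.integrable_of_hasCompactSupport hφ.2.1) measurable_id hf x

lemma prim_mem_testFun {U : Set (Pt n)} {x₀ : Pt n} {r : ℝ}
    (hU : Metric.closedBall x₀ (2 * r) ⊆ U) {φ f : Fun1 n} (hφ : φ ∈ TestFun (Metric.ball 0 r))
    (hf : f ∈ TestFun (Metric.ball x₀ r)) (i : Fin n) : prim φ f i ∈ TestFun U := by
  have hφ' := testFun_mono (subset_univ _) hφ
  have hf' := testFun_mono (subset_univ _) hf
  have hs : Function.support (prim φ f i) ⊆ Metric.closedBall x₀ (2 * r) := by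
    intro x hx
    by_contra hx2
    refine hx (integral_eq_zero_of_ae ?_)
    -- With the restriction outside the product, `t ∈ [0,1]` is available almost everywhere, so the
    -- translation by `t h` has length less than `r`.
    have : (volume : Measure (Pt n)).prod ((volume : Measure ℝ).restrict (Icc 0 1))
        = ((volume : Measure (Pt n)).prod (volume : Measure ℝ)).restrict (univ ×ˢ Icc 0 1) := by
      rw [← Measure.prod_restrict, Measure.restrict_univ]
    rw [this]
    filter_upwards [ae_restrict_mem (MeasurableSet.univ.prod measurableSet_Icc)] with p hp
    by_contra h0
    simp only [Pi.zero_apply, mul_eq_zero, not_or] at h0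
    have h1 := hφ.2.2 (subset_tsupport _ h0.1.1)
    have h2 := hf.2.2 (subset_tsupport _ h0.2)
    rw [mem_ball_zero_iff] at h1
    rw [mem_ball_iff_norm] at h2
    apply hx2
    rw [mem_closedBall_iff_norm]
    have h3 : ‖p.2 • p.1‖ ≤ ‖p.1‖ := by
      rw [norm_smul, Real.norm_of_nonneg hp.2.1]
      exact mul_le_of_le_one_left (norm_nonneg _) hp.2.2
    have h4 : x - x₀ = (x - p.2 • p.1 - x₀) + p.2 • p.1 := by abel
    rw [h4]
    linarith [norm_add_le (x - p.2 • p.1 - x₀) (p.2 • p.1)]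
  exact ⟨contDiff_translates (integrable_prim_weight hφ' i) measurable_smul_prod hf',
    .of_support_subset_isCompact (isCompact_closedBall _ _) hs,
    (closure_minimal hs Metric.isClosed_closedBall).trans hU⟩

/-! ### Functionals that vanish on derivatives -/

/-- `T` is linear on the test functions on `U` and vanishes on their derivatives. -/
structure KillsDerivatives (U : Set (Pt n)) (T : (Pt n → ℂ) → ℂ) : Prop where
  add : ∀ f ∈ TestFun U, ∀ g ∈ TestFun U, T (f + g) = T f + T g
  smul : ∀ f ∈ TestFun U, ∀ c : ℂ, T (c • f) = c * T f
  pd : ∀ f ∈ TestFun U, ∀ i, T (pd i f) = 0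

lemma zero_mem_testFun (U : Set (Pt n)) : (0 : Pt n → ℂ) ∈ TestFun U := by
  refine ⟨contDiff_const, HasCompactSupport.zero, ?_⟩
  have : tsupport (0 : Pt n → ℂ) = ∅ := tsupport_eq_empty_iff.2 rfl
  simp [this]

lemma KillsDerivatives.map_sum {U : Set (Pt n)} {T : (Pt n → ℂ) → ℂ} (hT : KillsDerivatives U T)
    {ι : Type*} (s : Finset ι) (F : ι → Pt n → ℂ) (hF : ∀ i ∈ s, F i ∈ TestFun U) :
    ∑ i ∈ s, F i ∈ TestFun U ∧ T (∑ i ∈ s, F i) = ∑ i ∈ s, T (F i) := by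
  classical
  induction s using Finset.induction_on with
  | empty =>
    refine ⟨by simpa using zero_mem_testFun U, ?_⟩
    have := hT.smul 0 (zero_mem_testFun U) 0
    simpa using this
  | insert i s hi ih =>
    obtain ⟨h1, h2⟩ := ih fun j hj => hF j (by simp [hj])
    have h3 := hF i (by simp)
    rw [Finset.sum_insert hi, Finset.sum_insert hi]
    exact ⟨add_mem_testFun h3 h1, by rw [hT.add _ h3 _ h1, h2]⟩

lemma shift_mem_testFun {x₀ : Pt n} {r : ℝ} {φ : Fun1 n} (hφ : φ ∈ TestFun (Metric.ball x₀ r)) :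
    (fun h => φ (x₀ + h)) ∈ TestFun (Metric.ball (0 : Pt n) r) := by
  refine ⟨hφ.1.comp (contDiff_const.add contDiff_id),
    hφ.2.1.comp_homeomorph (Homeomorph.addLeft x₀), ?_⟩
  intro h hh
  have : x₀ + h ∈ tsupport φ := by
    have := tsupport_comp_eq_preimage φ (Homeomorph.addLeft x₀)
    rw [Function.comp_def] at this
    simp only [Homeomorph.coe_addLeft] at this
    rw [this] at hh
    exact hh
  simpa using hφ.2.2 this

/-- `T` annihilates the sum of the derivatives of the primitives. Recentring `φ` at the origin keeps
the translations shorter than `r`, hence the primitives inside `U`. -/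
lemma KillsDerivatives.eq_conv {U : Set (Pt n)} {T : (Pt n → ℂ) → ℂ} (hT : KillsDerivatives U T)
    {x₀ : Pt n} {r : ℝ} (hr : 0 < r) (hU : Metric.closedBall x₀ (2 * r) ⊆ U) {φ f : Fun1 n}
    (hφ : φ ∈ TestFun (Metric.ball x₀ r)) (hf : f ∈ TestFun (Metric.ball x₀ r)) :
    T f * (∫ h, φ h) = T (fun x => ∫ h, φ (x₀ + h) * f (x - h)) := by
  have hφ0 := shift_mem_testFun hφ
  have hprim := prim_mem_testFun hU hφ0 hf
  obtain ⟨h1, h2⟩ := hT.map_sum Finset.univ (fun i => StokesSymbols.pd i (prim _ f i))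
    fun i _ => pd_mem_testFun (hprim i) i
  simp only [hT.pd _ (hprim _), Finset.sum_const_zero] at h2
  have hfU : f ∈ TestFun U := testFun_mono ((Metric.ball_subset_ball (by linarith)).trans
    (Metric.ball_subset_closedBall.trans hU)) hf
  have h3 : (fun x => ∫ h, φ (x₀ + h) * f (x - h)) = (∫ h, φ h) • f
      + (-1 : ℂ) • ∑ i, StokesSymbols.pd i (prim (fun h => φ (x₀ + h)) f i) := by
    funext x
    have := sum_pd_prim (testFun_mono (subset_univ _) hφ0) (testFun_mono (subset_univ _) hf) x
    rw [integral_add_left_eq_self φ x₀] at this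
    simp only [Pi.add_apply, Pi.smul_apply, Finset.sum_apply, this, smul_eq_mul]
    ring
  rw [h3, hT.add _ (smul_mem_testFun hfU _) _ (smul_mem_testFun h1 _), hT.smul _ hfU,
    hT.smul _ h1, h2]
  ring

lemma KillsDerivatives.mul_integral_comm {U : Set (Pt n)} {T : (Pt n → ℂ) → ℂ}
    (hT : KillsDerivatives U T) {x₀ : Pt n} {r : ℝ} (hr : 0 < r)
    (hU : Metric.closedBall x₀ (2 * r) ⊆ U) {φ f : Fun1 n}
    (hφ : φ ∈ TestFun (Metric.ball x₀ r)) (hf : f ∈ TestFun (Metric.ball x₀ r)) :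
    T f * (∫ h, φ h) = T φ * ∫ h, f h := by
  rw [hT.eq_conv hr hU hφ hf, hT.eq_conv hr hU hf hφ]
  congr 1
  funext x
  -- The reflection `h ↦ x - x₀ - h` exchanges `φ` and `f`: the recentred convolution is symmetric.
  rw [← integral_sub_left_eq_self (fun h => φ (x₀ + h) * f (x - h)) volume (x - x₀)]
  congr 1
  funext h
  rw [mul_comm]
  congr 2 <;> abel

lemma exists_testFun_integral_ne_zero {V : Set (Pt n)} (hV : IsOpen V) (hne : V.Nonempty) :
    ∃ φ ∈ TestFun V, ∫ x, φ x = 1 := by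
  obtain ⟨x, hx⟩ := hne
  obtain ⟨r, hr, hrV⟩ := Metric.isOpen_iff.1 hV x hx
  let b : ContDiffBump x := ⟨r / 4, r / 2, by positivity, by linarith⟩
  refine ⟨fun y => ((b.normed volume y : ℝ) : ℂ), ⟨?_, ?_, ?_⟩, ?_⟩
  · exact Complex.ofRealCLM.contDiff.comp b.contDiff_normed
  · exact b.hasCompactSupport_normed.comp_left (g := fun t : ℝ => (t : ℂ)) (by simp)
  · have h1 : tsupport (fun y => ((b.normed volume y : ℝ) : ℂ)) ⊆ tsupport (b.normed volume) :=
      closure_mono fun y hy => by simpa using hy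
    refine h1.trans ?_
    rw [b.tsupport_normed_eq]
    exact (Metric.closedBall_subset_ball (by simp [b]; linarith)).trans hrV
  · have := integral_ofReal (μ := (volume : Measure (Pt n))) (f := b.normed volume) (𝕜 := ℂ)
    rw [b.integral_normed] at this
    simpa using this

lemma KillsDerivatives.exists_locally {U : Set (Pt n)} (hUo : IsOpen U) (hUc : IsConnected U)
    {T : (Pt n → ℂ) → ℂ} (hT : KillsDerivatives U T) :
    ∃ c : ℂ, ∀ x ∈ U, ∃ V, IsOpen V ∧ x ∈ V ∧ V ⊆ U ∧ ∀ f ∈ TestFun V, T f = c * ∫ h, f h := by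
  have key : ∀ x ∈ U, ∃ r > 0, Metric.ball x r ⊆ U ∧ ∀ φ ∈ TestFun (Metric.ball x r),
      ∀ f ∈ TestFun (Metric.ball x r), T f * (∫ h, φ h) = T φ * ∫ h, f h := by
    intro x hx
    obtain ⟨r, hr, hrU⟩ := Metric.isOpen_iff.1 hUo x hx
    refine ⟨r / 4, by positivity, (Metric.ball_subset_ball (by linarith)).trans hrU,
      fun φ hφ f hf => hT.mul_integral_comm (by positivity)
        ((Metric.closedBall_subset_ball (by linarith)).trans hrU) hφ hf⟩
  obtain ⟨x₁, hx₁⟩ := hUc.nonempty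
  obtain ⟨r₁, hr₁, hb₁, hk₁⟩ := key x₁ hx₁
  obtain ⟨φ₁, hφ₁, hi₁⟩ := exists_testFun_integral_ne_zero Metric.isOpen_ball
    ⟨x₁, Metric.mem_ball_self hr₁⟩
  -- The points near which the constant `T φ₁` is right form an open set that is also closed
  -- relative to `U`.
  let A : Set (Pt n) := {x | ∃ V, IsOpen V ∧ x ∈ V ∧ V ⊆ U ∧
    ∀ f ∈ TestFun V, T f = T φ₁ * ∫ h, f h}
  have hA : IsOpen A := by
    rw [isOpen_iff_mem_nhds]
    rintro x ⟨V, hV, hx, h⟩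
    filter_upwards [hV.mem_nhds hx] with y hy
    exact ⟨V, hV, hy, h⟩
  refine ⟨T φ₁, hUc.isPreconnected.subset_of_closure_inter_subset hA
    ⟨x₁, hx₁, _, Metric.isOpen_ball, Metric.mem_ball_self hr₁, hb₁, fun f hf => ?_⟩ ?_⟩
  · have := hk₁ φ₁ hφ₁ f hf
    rwa [hi₁, mul_one] at this
  · rintro x ⟨hxA, hxU⟩
    obtain ⟨r, hr, hb, hk⟩ := key x hxU
    obtain ⟨y, hyr, V, hV, hyV, -, hVc⟩ :=
      mem_closure_iff_nhds.1 hxA _ (Metric.ball_mem_nhds x hr)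
    -- A test function of integral `1` in the overlap carries the constant from `V` to the ball
    -- around `x`.
    obtain ⟨φ, hφ, hi⟩ := exists_testFun_integral_ne_zero (Metric.isOpen_ball.inter hV)
      ⟨y, hyr, hyV⟩
    refine ⟨_, Metric.isOpen_ball, Metric.mem_ball_self hr, hb, fun f hf => ?_⟩
    have := hk φ (testFun_mono inter_subset_left hφ) f hf
    rwa [hi, mul_one, hVc φ (testFun_mono inter_subset_right hφ), hi, mul_one] at this

/-- A partition of unity for two sets: with `θ = 1` near the part of the support outside `W`, take
`θ f` and `(1 - θ) f`. -/
lemma testFun_split {V W : Set (Pt n)} (hV : IsOpen V) (hW : IsOpen W) {f : Pt n → ℂ}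
    (hf : f ∈ TestFun (V ∪ W)) : ∃ g ∈ TestFun V, ∃ h ∈ TestFun W, f = g + h := by
  have hK : IsCompact (tsupport f \ W) := hf.2.1.isCompact.diff hW
  obtain ⟨θ, hθ, N, hN, hKN, hθ1⟩ := exists_testFun_eq_one hK hV
    fun x hx => (hf.2.2 hx.1).resolve_right hx.2
  have h1 := mul_mem_testFun hθ hf.1
  have h2 := mul_mem_testFun hf (contDiff_const (c := (1 : ℂ)).sub hθ.1)
  refine ⟨_, h1, _, ⟨h2.1, h2.2.1, ?_⟩, ?_⟩
  · intro x hx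
    by_contra hxW
    have hxf : x ∈ tsupport f := tsupport_smul_subset_right (fun x => 1 - θ x) f hx
    have hxN : x ∈ N := hKN ⟨hxf, hxW⟩
    refine notMem_tsupport_iff_eventuallyEq.2 ?_ hx
    filter_upwards [hN.mem_nhds hxN] with y hy
    simp [hθ1 y hy]
  · funext x
    simp only [Pi.add_apply]
    ring

lemma integrable_testFun {U : Set (Pt n)} {f : Pt n → ℂ} (hf : f ∈ TestFun U) : Integrable f :=
  hf.1.continuous.integrable_of_hasCompactSupport hf.2.1

/-- A linear functional on the test functions on a connected open set which vanishes on
derivatives is a multiple of the integral. -/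
theorem KillsDerivatives.exists_eq_integral {U : Set (Pt n)} (hUo : IsOpen U) (hUc : IsConnected U)
    {T : (Pt n → ℂ) → ℂ} (hT : KillsDerivatives U T) :
    ∃ c : ℂ, ∀ f ∈ TestFun U, T f = c * ∫ h, f h := by
  obtain ⟨c, hc⟩ := hT.exists_locally hUo hUc
  refine ⟨c, fun f hf => ?_⟩
  -- Compactness of the support reduces the global formula to unions of two open sets, where
  -- `testFun_split` applies.
  have : ∃ V, IsOpen V ∧ tsupport f ⊆ V ∧ V ⊆ U ∧ ∀ f ∈ TestFun V, T f = c * ∫ h, f h := by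
    refine hf.2.1.isCompact.induction_on
      (p := fun s => ∃ V, IsOpen V ∧ s ⊆ V ∧ V ⊆ U ∧ ∀ f ∈ TestFun V, T f = c * ∫ h, f h)
      ⟨∅, isOpen_empty, Subset.rfl, empty_subset _, fun f hf => ?_⟩ ?_ ?_ ?_
    · have : f = 0 := tsupport_eq_empty_iff.1 (subset_empty_iff.1 hf.2.2)
      have h0 := hT.smul 0 (zero_mem_testFun U) 0
      simpa [this] using h0
    · rintro s t hst ⟨V, hV, htV, h⟩
      exact ⟨V, hV, hst.trans htV, h⟩
    · rintro s t ⟨V, hV, hsV, hVU, h⟩ ⟨W, hW, htW, hWU, h'⟩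
      refine ⟨V ∪ W, hV.union hW, union_subset_union hsV htW, union_subset hVU hWU,
        fun f hf => ?_⟩
      obtain ⟨g, hg, k, hk, rfl⟩ := testFun_split hV hW hf
      rw [hT.add _ (testFun_mono hVU hg) _ (testFun_mono hWU hk), h g hg, h' k hk]
      simp only [Pi.add_apply]
      rw [integral_add (integrable_testFun hg) (integrable_testFun hk), mul_add]
    · intro x hx
      obtain ⟨V, hV, hxV, h⟩ := hc x (hf.2.2 hx)
      exact ⟨V, mem_nhdsWithin_of_mem_nhds (hV.mem_nhds hxV), V, hV, Subset.rfl, h⟩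
  obtain ⟨V, -, hfV, -, h⟩ := this
  exact h f ⟨hf.1, hf.2.1, hfV⟩

/-! ### Symbols with constant coefficients -/

lemma IsSymbolCC.add {m : ℝ} {σ τ : Fun1 n} (hσ : IsSymbolCC m σ) (hτ : IsSymbolCC m τ) :
    IsSymbolCC m (fun ξ => σ ξ + τ ξ) := by
  refine ⟨hσ.1.add hτ.1, fun β => ?_⟩
  obtain ⟨C, hC⟩ := hσ.2 β
  obtain ⟨C', hC'⟩ := hτ.2 β
  refine ⟨C + C', fun ξ => ?_⟩
  have := iterPd_add isOpen_univ hσ.1.contDiffOn hτ.1.contDiffOn β (mem_univ ξ)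
  have h2 : iterPd β (fun ξ => σ ξ + τ ξ) ξ = iterPd β σ ξ + iterPd β τ ξ := this
  rw [h2, add_mul]
  exact (norm_add_le _ _).trans (add_le_add (hC ξ) (hC' ξ))

lemma IsSymbolCC.pd {m : ℝ} {σ : Fun1 n} (hσ : IsSymbolCC m σ) (i : Fin n) :
    IsSymbolCC (m - 1) (pd i σ) := by
  refine ⟨contDiff_pd hσ.1 i, fun β => ?_⟩
  obtain ⟨C, hC⟩ := hσ.2 (β ++ [i])
  refine ⟨C, fun ξ => ?_⟩
  rw [iterPd_pd]
  refine (hC ξ).trans_eq ?_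
  congr 2
  simp
  ring

lemma exists_bound_rpow_of_testFun {f : Fun1 n} (hf : f ∈ TestFun univ) (p : ℝ) :
    ∃ C : ℝ, ∀ ξ, ‖f ξ‖ ≤ C * (1 + ‖ξ‖) ^ p := by
  have hc : Continuous fun ξ : Pt n => (((1 + ‖ξ‖) ^ (-p) : ℝ) : ℂ) :=
    Complex.continuous_ofReal.comp ((by fun_prop : Continuous fun ξ : Pt n => 1 + ‖ξ‖).rpow_const
      fun ξ => Or.inl (by positivity))
  obtain ⟨C, hC⟩ := (hf.2.1.mul_left (f := fun ξ : Pt n => (((1 + ‖ξ‖) ^ (-p) : ℝ) : ℂ))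
    ).exists_bound_of_continuous (hc.mul hf.1.continuous)
  refine ⟨C, fun ξ => ?_⟩
  have h := hC ξ
  simp only [Pi.mul_apply, norm_mul, Complex.norm_real] at h
  have hp : 0 < (1 + ‖ξ‖) ^ p := by positivity
  rw [Real.norm_of_nonneg (by positivity), Real.rpow_neg (by positivity), inv_mul_le_iff₀ hp] at h
  linarith

lemma iterPd_mem_testFun {U : Set (Pt n)} {f : Fun1 n} (hf : f ∈ TestFun U) (β : List (Fin n)) :
    iterPd β f ∈ TestFun U := by
  induction β with
  | nil => exact hf
  | cons i β ih => exact pd_mem_testFun ih i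

lemma isSymbolCC_of_testFun {f : Fun1 n} (hf : f ∈ TestFun univ) (m : ℝ) : IsSymbolCC m f :=
  ⟨hf.1, fun β => exists_bound_rpow_of_testFun (iterPd_mem_testFun hf β) _⟩

lemma isSymbolCC_sum_of_testFun {N : ℕ} {f : ℕ → Fun1 n} (hf : ∀ j, f j ∈ TestFun univ) (m : ℝ) :
    IsSymbolCC m (fun ξ => ∑ j ∈ Finset.range N, f j ξ) := by
  induction N with
  | zero =>
    have := isSymbolCC_of_testFun (zero_mem_testFun (n := n) univ) m
    simp only [Finset.range_zero, Finset.sum_empty]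
    exact this
  | succ N ih =>
    simp only [Finset.sum_range_succ]
    exact ih.add (isSymbolCC_of_testFun (hf N) m)

/-- Differentiate the homogeneity relation in `ξ` and cancel the factor `t` from the chain rule. -/
lemma pd_homogeneous {w : ℂ} {s : Fun1 n} (hs : ContDiffOn ℝ ∞ s {0}ᶜ)
    (hom : ∀ ξ, ξ ≠ 0 → ∀ t : ℝ, 0 < t → s (t • ξ) = (t : ℂ) ^ w * s ξ) (i : Fin n)
    {ξ : Pt n} (hξ : ξ ≠ 0) {t : ℝ} (ht : 0 < t) :
    pd i s (t • ξ) = (t : ℂ) ^ (w - 1) * pd i s ξ := by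
  have hd : ∀ η : Pt n, η ≠ 0 → HasFDerivAt s (fderiv ℝ s η) η := fun η hη =>
    (differentiableAt_of_mem isOpen_compl_singleton hs hη).hasFDerivAt
  have h1 : HasFDerivAt (fun η => s (t • η))
      ((fderiv ℝ s (t • ξ)).comp (t • ContinuousLinearMap.id ℝ (Pt n))) ξ :=
    (hd (t • ξ) (smul_ne_zero ht.ne' hξ)).comp ξ ((hasFDerivAt_id ξ).const_smul t)
  have h2 : HasFDerivAt (fun η => (t : ℂ) ^ w * s η) ((t : ℂ) ^ w • fderiv ℝ s ξ) ξ :=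
    (hd ξ hξ).const_mul _
  have h3 : (fun η => s (t • η)) =ᶠ[𝓝 ξ] fun η => (t : ℂ) ^ w * s η := by
    filter_upwards [isOpen_compl_singleton.mem_nhds hξ] with η hη
    exact hom η hη t ht
  have h4 := congrArg (fun L : Pt n →L[ℝ] ℂ => L (basisVec i)) (h1.unique (h2.congr_of_eventuallyEq h3))
  have ht0 : (t : ℂ) ≠ 0 := by exact_mod_cast ht.ne'
  simp only [ContinuousLinearMap.comp_apply, _root_.smul_apply, ContinuousLinearMap.id_apply,
    map_smul, smul_eq_mul, Complex.real_smul] at h4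
  rw [Complex.cpow_sub _ _ ht0, Complex.cpow_one]
  simp only [pd]
  field_simp
  linear_combination h4

lemma IsExpansionCC.contDiff {χ : Pt n → ℝ} {a : ℂ} {σ : Fun1 n} {s : ℕ → Fun1 n}
    (h : IsExpansionCC χ a σ s) : ContDiff ℝ ∞ σ := by
  simpa using (h.2.2 0).1

/-- The difference is `(∂_i χ) s`, which lives where `χ` is not locally constant, inside the unit
ball and away from `0`. -/
lemma cutoff_commutator_mem_testFun {χ : Pt n → ℝ} (hχ : IsCutoff χ) {s : Fun1 n}
    (hs : ContDiffOn ℝ ∞ s {0}ᶜ) (i : Fin n) :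
    (fun ξ => pd i (fun η => (χ η : ℂ) * s η) ξ - (χ ξ : ℂ) * pd i s ξ) ∈ TestFun univ := by
  refine ⟨(contDiff_pd (contDiff_cutoff_mul hχ le_rfl hs) i).sub
    (contDiff_cutoff_mul hχ le_rfl (contDiffOn_pd isOpen_compl_singleton hs i)),
    HasCompactSupport.intro (isCompact_closedBall 0 1) fun ξ hξ => ?_, subset_univ _⟩
  have hξ1 : 1 < ‖ξ‖ := by simpa using hξ
  have : (fun η => (χ η : ℂ) * s η) =ᶠ[𝓝 ξ] s := by
    filter_upwards [(isOpen_lt continuous_const continuous_norm).mem_nhds hξ1] with η hη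
    simp [hχ.2.2 η (le_of_lt hη)]
  simp [pd, this.fderiv_eq, hχ.2.2 ξ hξ1.le]

/-- The expansion may be differentiated termwise: the new remainder differs from the derivative of
the old one by commutators with `χ`, which are test functions and so have every order. -/
lemma IsExpansionCC.pd {χ : Pt n → ℝ} (hχ : IsCutoff χ) {a : ℂ} {σ : Fun1 n} {s : ℕ → Fun1 n}
    (h : IsExpansionCC χ (a + 1) σ s) (i : Fin n) :
    IsExpansionCC χ a (pd i σ) (fun j => StokesSymbols.pd i (s j)) := by
  have hσ := h.contDiff
  obtain ⟨h1, h2, h3⟩ := h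
  refine ⟨fun j => contDiffOn_pd isOpen_compl_singleton (h1 j) i, fun j ξ hξ t ht => ?_,
    fun N => ?_⟩
  · refine (pd_homogeneous (h1 j) (h2 j) i hξ ht).trans ?_
    congr 2
    ring
  · have h4 := ((h3 N).pd i).add (isSymbolCC_sum_of_testFun (N := N)
      (fun j => cutoff_commutator_mem_testFun hχ (h1 j) i) ((a + 1).re - N - 1))
    have e : (a + 1).re - N - 1 = a.re - N := by simp; ring
    rw [e] at h4
    convert h4 using 1
    funext ξ
    have hd : ∀ j, DifferentiableAt ℝ (fun ξ => (χ ξ : ℂ) * s j ξ) ξ := fun j =>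
      (contDiff_cutoff_mul hχ le_rfl (h1 j)).differentiable (by simp) ξ
    have h5 : StokesSymbols.pd i (fun ξ => σ ξ - ∑ j ∈ Finset.range N, (χ ξ : ℂ) * s j ξ) ξ
        = StokesSymbols.pd i σ ξ
          - ∑ j ∈ Finset.range N, StokesSymbols.pd i (fun ξ => (χ ξ : ℂ) * s j ξ) ξ := by
      simp only [StokesSymbols.pd]
      rw [fderiv_fun_sub (hσ.differentiable (by simp) ξ) (DifferentiableAt.fun_sum fun j _ => hd j),
        fderiv_fun_sum fun j _ => hd j]
      simp
    rw [h5, Finset.sum_sub_distrib]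
    ring

/-- Smooth functions which decay rapidly together with their derivatives. -/
def RapidDecay (r : Fun1 n) : Prop :=
  ContDiff ℝ ∞ r ∧ ∀ (p : ℝ) (β : List (Fin n)), ∃ C : ℝ, ∀ ξ, ‖iterPd β r ξ‖ ≤ C * (1 + ‖ξ‖) ^ p

lemma RapidDecay.isSymbolCC {r : Fun1 n} (h : RapidDecay r) (m : ℝ) : IsSymbolCC m r :=
  ⟨h.1, fun β => h.2 _ β⟩

lemma RapidDecay.mem_smoothing {r : Fun1 n} (h : RapidDecay r) (χ : Pt n → ℝ) :
    r ∈ CSccSmoothing χ := by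
  refine mem_iInter.2 fun a => ⟨fun _ _ => 0, fun j => contDiffOn_const, by simp, fun N => ?_⟩
  simpa using h.isSymbolCC _

lemma rapidDecay_of_testFun {r : Fun1 n} (h : r ∈ TestFun univ) : RapidDecay r :=
  ⟨h.1, fun _ β => exists_bound_rpow_of_testFun (iterPd_mem_testFun h β) _⟩

lemma rapidDecay_of_mem_smoothing {r : Fun1 n} {χ : Pt n → ℝ} (h : r ∈ CSccSmoothing χ) :
    RapidDecay r := by
  have h0 : ∀ a : ℂ, IsSymbolCC a.re r := fun a => by
    obtain ⟨s, hs⟩ := mem_iInter.1 h a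
    simpa using hs.2.2 0
  refine ⟨(h0 0).1, fun p β => ?_⟩
  -- The order is raised by `|β|` to offset the gain in the symbol estimate.
  obtain ⟨C, hC⟩ := (h0 ((p + β.length : ℝ) : ℂ)).2 β
  exact ⟨C, by simpa using hC⟩

lemma RapidDecay.exists_bound {r : Fun1 n} (h : RapidDecay r) (p : ℝ) (m : ℕ) :
    ∃ C : ℝ, 0 < C ∧ ∀ β : List (Fin n), β.length ≤ m → ∀ ξ,
      ‖iterPd β r ξ‖ ≤ C * (1 + ‖ξ‖) ^ p := by
  choose C hC using h.2 p
  obtain ⟨M, hM⟩ := ((finite_words (n := n) m).image C).bddAbove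
  refine ⟨max M 1, by positivity, fun β hβ x => ?_⟩
  refine (hC β x).trans ?_
  gcongr
  exact (hM ⟨β, hβ, rfl⟩).trans (le_max_left _ _)

lemma RapidDecay.mul {g r : Fun1 n} (hr : RapidDecay r) (hg : ContDiff ℝ ∞ g)
    (hb : ∀ β, ∃ C : ℝ, ∀ x, ‖iterPd β g x‖ ≤ C) : RapidDecay (fun ξ => g ξ * r ξ) := by
  refine ⟨hg.mul hr.1, fun p β => ?_⟩
  obtain ⟨A, hA0, hA⟩ := exists_bound_iterPd hb β.length
  obtain ⟨B, hB0, hB⟩ := hr.exists_bound p β.length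
  refine ⟨2 ^ β.length * (A * B), fun ξ => ?_⟩
  refine (norm_iterPd_mul_le isOpen_univ hg.contDiffOn hr.1.contDiffOn β (mem_univ ξ)
    (fun α hα => hA α hα ξ) (fun α hα => hB α hα ξ)).trans_eq (by ring)

lemma RapidDecay.integrable {r : Fun1 n} (h : RapidDecay r) : Integrable r := by
  obtain ⟨C, hC⟩ := h.2 (-(n + 1)) []
  have hI : Integrable (fun ξ : Pt n => (1 + ‖ξ‖) ^ (-(n + 1 : ℝ))) :=
    integrable_one_add_norm (by simp)
  exact (hI.const_mul C).mono' h.1.continuous.aestronglyMeasurable (.of_forall hC)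

/-! ### Truncation of rapidly decaying functions -/

/-- Compactness gives the bound on the unit ball; outside it `χ` is constant. -/
lemma exists_bound_cutoff {χ : Pt n → ℝ} (hχ : IsCutoff χ) (β : List (Fin n)) :
    ∃ C : ℝ, ∀ x, ‖iterPd β (fun ξ => (χ ξ : ℂ)) x‖ ≤ C := by
  have hsm : ContDiff ℝ ∞ (fun ξ => (χ ξ : ℂ)) := Complex.ofRealCLM.contDiff.comp hχ.1
  obtain ⟨M, hM⟩ := (isCompact_closedBall (0 : Pt n) 1).exists_bound_of_continuousOn
    (contDiff_iterPd hsm β).continuous.continuousOn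
  have h1 : ∀ β : List (Fin n), ∀ x, ‖iterPd β (fun _ : Pt n => (1 : ℂ)) x‖ ≤ 1 := by
    intro β
    have : iterPd β (fun _ : Pt n => (1 : ℂ)) = (fun _ => 1) ∨
        iterPd β (fun _ : Pt n => (1 : ℂ)) = fun _ => 0 := by
      induction β with
      | nil => exact Or.inl rfl
      | cons i β ih =>
        right
        rcases ih with h | h <;> funext x <;> simp [iterPd_cons, pd, h]
    rcases this with h | h <;> simp [h]
  refine ⟨max M 1, fun x => ?_⟩
  by_cases hx : ‖x‖ ≤ 1
  · exact (hM x (by simpa using hx)).trans (le_max_left _ _)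
  · have : (fun ξ => (χ ξ : ℂ)) =ᶠ[𝓝 x] fun _ => 1 := by
      filter_upwards [(isOpen_lt continuous_const continuous_norm).mem_nhds
        (not_le.1 hx)] with η hη
      simp [hχ.2.2 η (le_of_lt hη)]
    rw [(iterPd_eventuallyEq this β).eq_of_nhds]
    exact (h1 β x).trans (le_max_right _ _)

lemma iterPd_comp_smul {f : Fun1 n} (hf : ContDiff ℝ ∞ f) (t : ℝ) (β : List (Fin n)) :
    iterPd β (fun ξ => f (t • ξ)) = fun ξ => (t : ℂ) ^ β.length * iterPd β f (t • ξ) := by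
  induction β with
  | nil => simp [iterPd]
  | cons i β ih =>
    funext ξ
    rw [iterPd_cons, ih, pd]
    have hd := ((contDiff_iterPd hf β).differentiable (by simp) (t • ξ)).hasFDerivAt
    have h1 : HasFDerivAt (fun ξ => (t : ℂ) ^ β.length * iterPd β f (t • ξ))
        ((t : ℂ) ^ β.length • (fderiv ℝ (iterPd β f) (t • ξ)).comp
          (t • ContinuousLinearMap.id ℝ (Pt n))) ξ :=
      (hd.comp ξ ((hasFDerivAt_id ξ).const_smul t)).const_mul _
    rw [h1.fderiv]
    simp [iterPd_cons, pd, pow_succ]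
    ring

lemma exists_bound_dilated_cutoff {χ : Pt n → ℝ} (hχ : IsCutoff χ) (m : ℕ) :
    ∃ C : ℝ, 0 < C ∧ ∀ k : ℕ, 0 < k → ∀ β : List (Fin n), β.length ≤ m → ∀ x,
      ‖iterPd β (fun ξ => (χ ((k : ℝ)⁻¹ • ξ) : ℂ)) x‖ ≤ C := by
  obtain ⟨C, hC0, hC⟩ := exists_bound_iterPd (exists_bound_cutoff hχ) m
  refine ⟨C, hC0, fun k hk β hβ x => ?_⟩
  rw [iterPd_comp_smul (f := fun ξ => (χ ξ : ℂ)) (Complex.ofRealCLM.contDiff.comp hχ.1)]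
  rw [norm_mul, norm_pow, Complex.norm_real]
  have hk1 : (1 : ℝ) ≤ k := by exact_mod_cast hk
  have h1 : ‖(k : ℝ)⁻¹‖ ^ β.length ≤ 1 := by
    refine pow_le_one₀ (norm_nonneg _) ?_
    rw [norm_inv, Real.norm_of_nonneg (by positivity)]
    exact inv_le_one_of_one_le₀ hk1
  calc _ ≤ 1 * C := mul_le_mul h1 (hC β hβ _) (norm_nonneg _) zero_le_one
    _ = C := one_mul C

lemma contDiff_dilated_cutoff {χ : Pt n → ℝ} (hχ : IsCutoff χ) (t : ℝ) :
    ContDiff ℝ ∞ (fun ξ => (χ (t • ξ) : ℂ)) :=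
  Complex.ofRealCLM.contDiff.comp (hχ.1.comp (contDiff_const_smul t))

/-- The part of `r` at distance of order at least `k` from the origin. -/
def tail (χ : Pt n → ℝ) (r : Fun1 n) (k : ℕ) : Fun1 n := fun ξ => (χ ((k : ℝ)⁻¹ • ξ) : ℂ) * r ξ

lemma RapidDecay.tail {χ : Pt n → ℝ} (hχ : IsCutoff χ) {r : Fun1 n} (hr : RapidDecay r) {k : ℕ}
    (hk : 0 < k) : RapidDecay (tail χ r k) :=
  hr.mul (contDiff_dilated_cutoff hχ _) fun β => by
    obtain ⟨C, -, hC⟩ := exists_bound_dilated_cutoff hχ β.length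
    exact ⟨C, hC k hk β le_rfl⟩

lemma sub_tail_mem_testFun {χ : Pt n → ℝ} (hχ : IsCutoff χ) {r : Fun1 n} (hr : RapidDecay r)
    {k : ℕ} (hk : 0 < k) : r - tail χ r k ∈ TestFun univ := by
  refine ⟨hr.1.sub (hr.tail hχ hk).1,
    HasCompactSupport.intro (isCompact_closedBall 0 k) fun ξ hξ => ?_, subset_univ _⟩
  have hξ1 : k < ‖ξ‖ := by simpa using hξ
  have hk0 : (0 : ℝ) < k := by exact_mod_cast hk
  have : χ ((k : ℝ)⁻¹ • ξ) = 1 := hχ.2.2 _ (by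
    rw [norm_smul, norm_inv, Real.norm_of_nonneg hk0.le, ← div_eq_inv_mul, le_div_iff₀ hk0]
    linarith)
  simp [StokesSymbols.tail, this]

/-- The tail vanishes for `|ξ| < k r₀`; on the rest, one spare power of `1 + |ξ|` is traded for
`1/k`. Derivatives of the dilated cut-off are bounded uniformly in `k`. -/
lemma RapidDecay.exists_tail_bound {χ : Pt n → ℝ} (hχ : IsCutoff χ) {r : Fun1 n}
    (hr : RapidDecay r) (m : ℕ) (p : ℝ) :
    ∃ C : ℝ, 0 < C ∧ ∀ k : ℕ, 0 < k → ∀ β : List (Fin n), β.length ≤ m → ∀ ξ,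
      ‖iterPd β (StokesSymbols.tail χ r k) ξ‖ ≤ C / k * (1 + ‖ξ‖) ^ p := by
  obtain ⟨A, hA0, hA⟩ := exists_bound_dilated_cutoff hχ m
  obtain ⟨B, hB0, hB⟩ := hr.exists_bound (p - 1) m
  obtain ⟨r₀, hr₀, h0⟩ := hχ.2.1
  refine ⟨2 ^ m * (A * B) / r₀, by positivity, fun k hk β hβ ξ => ?_⟩
  have hk0 : (0 : ℝ) < k := by exact_mod_cast hk
  by_cases hξ : ‖ξ‖ < k * r₀
  · have : StokesSymbols.tail χ r k =ᶠ[𝓝 ξ] fun _ => 0 := by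
      filter_upwards [(isOpen_lt continuous_norm continuous_const).mem_nhds hξ] with η hη
      have : χ ((k : ℝ)⁻¹ • η) = 0 := h0 _ (by
        rw [norm_smul, norm_inv, Real.norm_of_nonneg hk0.le, ← div_eq_inv_mul, div_lt_iff₀ hk0,
          mul_comm]
        exact hη)
      simp [StokesSymbols.tail, this]
    rw [(iterPd_eventuallyEq this β).eq_of_nhds]
    have h1 : iterPd β (fun _ : Pt n => (0 : ℂ)) = fun _ => 0 := by
      clear hβ
      induction β with
      | nil => rfl
      | cons i β ih => funext x; simp [iterPd_cons, pd, ih]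
    rw [h1, norm_zero]
    positivity
  · have h1 := norm_iterPd_mul_le isOpen_univ (contDiff_dilated_cutoff hχ (k : ℝ)⁻¹).contDiffOn
      hr.1.contDiffOn β (mem_univ ξ) (fun α hα => hA k hk α (hα.trans hβ) ξ)
      (fun α hα => hB α (hα.trans hβ) ξ)
    refine h1.trans ?_
    have h2 : (2 : ℝ) ^ β.length ≤ 2 ^ m := pow_le_pow_right₀ one_le_two hβ
    have h3 : (1 + ‖ξ‖) ^ (p - 1) ≤ (1 + ‖ξ‖) ^ p / (k * r₀) := by
      rw [Real.rpow_sub_one (by positivity)]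
      gcongr
      linarith
    calc _ ≤ 2 ^ m * (A * (B * ((1 + ‖ξ‖) ^ p / (k * r₀)))) := by gcongr
      _ = _ := by field_simp

/-! ### Symbols with compact support in `U` -/

lemma rpow_neg_mul_le_iff {x : ℝ} (hx : 0 < x) {p q y ε : ℝ} (hpq : q = -p) :
    x ^ p * y ≤ ε ↔ y ≤ ε * x ^ q := by
  have h : 0 < x ^ p := Real.rpow_pos_of_pos hx p
  rw [hpq, Real.rpow_neg hx.le, ← div_eq_mul_inv, le_div_iff₀ h, mul_comm]

lemma SeminormsLE.mono {χ : Pt n → ℝ} {U : Set (Pt n)} {a : ℂ} {m m' : ℕ} {ε ε' : ℝ}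
    {σ : Fun2 n} (h : SeminormsLE χ U a m ε σ) (hm : m' ≤ m) (hε : ε ≤ ε') :
    SeminormsLE χ U a m' ε' σ := by
  obtain ⟨s, hs, h⟩ := h
  refine ⟨s, hs, fun γ β hγ hβ => ⟨fun N hN x ξ => ?_, fun j hj x ξ hξ => ?_⟩⟩
  · exact ((h γ β (hγ.trans hm) (hβ.trans hm)).1 N (hN.trans hm) x ξ).trans hε
  · exact ((h γ β (hγ.trans hm) (hβ.trans hm)).2 j (hj.trans hm) x ξ hξ).trans hε

lemma IsSymbol.mulX {U : Set (Pt n)} {m : ℝ} {σ : Fun2 n} (h : IsSymbol U m σ) {ψ : Pt n → ℂ}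
    (hψ : ψ ∈ TestFun U) : IsSymbol U m (mulX ψ σ) := by
  obtain ⟨h1, ⟨K, hK, hKU, h2⟩, h3⟩ := h
  refine ⟨(hψ.1.comp contDiff_fst).mul h1, ⟨K, hK, hKU, fun x hx ξ => ?_⟩, fun γ β => ?_⟩
  · simp [StokesSymbols.mulX, h2 x hx]
  · obtain ⟨A, hA0, hA⟩ := exists_bound_iterPd (exists_bound_of_hasCompactSupport hψ.1 hψ.2.1)
      γ.length
    choose C hC using fun γ => h3 γ β
    obtain ⟨M, hM⟩ := ((finite_words (n := n) γ.length).image C).bddAbove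
    refine ⟨2 ^ γ.length * (A * M), fun x ξ => ?_⟩
    refine (norm_iterPd2_mulX_le hψ.1 isOpen_univ (by simpa using h1.contDiffOn) γ β x (mem_univ ξ)
      (fun α hα => hA α hα x) (B := M * (1 + ‖ξ‖) ^ (m - β.length)) fun α hα => ?_).trans_eq
      (by ring)
    refine (hC α x ξ).trans ?_
    gcongr
    exact hM ⟨α, hα, rfl⟩

lemma remainder_mulX (χ : Pt n → ℝ) (ψ : Pt n → ℂ) (σ : Fun2 n) (s : ℕ → Fun2 n) (N : ℕ) :
    remainder χ (mulX ψ σ) (fun j => mulX ψ (s j)) N = mulX ψ (remainder χ σ s N) := by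
  funext x ξ
  simp only [remainder, mulX, mul_sub, Finset.mul_sum]
  congr 1
  exact Finset.sum_congr rfl fun j _ => by ring

lemma IsExpansion.mulX {χ : Pt n → ℝ} {U : Set (Pt n)} {a : ℂ} {σ : Fun2 n} {s : ℕ → Fun2 n}
    (h : IsExpansion χ U a σ s) {ψ : Pt n → ℂ} (hψ : ψ ∈ TestFun U) :
    IsExpansion χ U a (mulX ψ σ) (fun j => mulX ψ (s j)) := by
  obtain ⟨h1, h2, h3⟩ := h
  refine ⟨fun j => ((hψ.1.comp contDiff_fst).contDiffOn).mul (h1 j), fun j x ξ hξ t ht => ?_,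
    fun N => ?_⟩
  · simp only [StokesSymbols.mulX, h2 j x ξ hξ t ht]
    ring
  · rw [remainder_mulX]
    exact (h3 N).mulX hψ

/-- Multiplication by a test function is continuous on the symbols of order `a`. -/
lemma exists_seminormsLE_mulX {χ : Pt n → ℝ} {U : Set (Pt n)} (a : ℂ) {ψ : Pt n → ℂ}
    (hψ : ψ ∈ TestFun U) (m : ℕ) : ∃ C : ℝ, 0 < C ∧ ∀ (σ : Fun2 n) (ε : ℝ), 0 ≤ ε →
      SeminormsLE χ U a m ε σ → SeminormsLE χ U a m (C * ε) (mulX ψ σ) := by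
  obtain ⟨A, hA0, hA⟩ := exists_bound_iterPd (exists_bound_of_hasCompactSupport hψ.1 hψ.2.1) m
  refine ⟨2 ^ m * A, by positivity, fun σ ε hε ⟨s, hs, h⟩ => ⟨_, hs.mulX hψ, fun γ β hγ hβ =>
    ⟨fun N hN x ξ => ?_, fun j hj x ξ hξ => ?_⟩⟩⟩
  · have h2 : (2 : ℝ) ^ γ.length ≤ 2 ^ m := pow_le_pow_right₀ one_le_two hγ
    rw [remainder_mulX]
    rw [rpow_neg_mul_le_iff (by positivity) rfl]
    refine (norm_iterPd2_mulX_le hψ.1 isOpen_univ (by simpa using (hs.2.2 N).1.contDiffOn) γ β x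
      (mem_univ ξ) (fun α hα => hA α (hα.trans hγ) x)
      (B := ε * (1 + ‖ξ‖) ^ (-(-a.re + N + β.length))) fun α hα => ?_).trans ?_
    · rw [← rpow_neg_mul_le_iff (by positivity) rfl]
      exact (h α β (hα.trans hγ) hβ).1 N hN x ξ
    · calc _ ≤ 2 ^ m * (A * (ε * (1 + ‖ξ‖) ^ (-(-a.re + N + β.length)))) := by gcongr
        _ = _ := by ring
  · have h2 : (2 : ℝ) ^ γ.length ≤ 2 ^ m := pow_le_pow_right₀ one_le_two hγ
    have hξ0 : ξ ∈ ({0}ᶜ : Set (Pt n)) := by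
      intro h0
      rw [mem_singleton_iff] at h0
      simp [h0] at hξ
    refine (norm_iterPd2_mulX_le hψ.1 isOpen_compl_singleton (hs.1 j) γ β x hξ0
      (fun α hα => hA α (hα.trans hγ) x) (fun α hα =>
        (h α β (hα.trans hγ) hβ).2 j hj x ξ hξ)).trans ?_
    calc _ ≤ 2 ^ m * (A * ε) := by gcongr
      _ = _ := by ring

lemma isSymbol_tensor {U : Set (Pt n)} {f : Pt n → ℂ} (hf : f ∈ TestFun U) {σ : Fun1 n} {m : ℝ}
    (h : IsSymbolCC m σ) : IsSymbol U m (tensor f σ) := by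
  refine ⟨(hf.1.comp contDiff_fst).mul (h.1.comp contDiff_snd),
    ⟨tsupport f, hf.2.1.isCompact, hf.2.2, fun x hx ξ => ?_⟩, fun γ β => ?_⟩
  · simp [tensor, image_eq_zero_of_notMem_tsupport hx]
  · obtain ⟨A, hA⟩ := exists_bound_of_hasCompactSupport hf.1 hf.2.1 γ
    obtain ⟨C, hC⟩ := h.2 β
    refine ⟨A * C, fun x ξ => ?_⟩
    rw [iterPd2_tensor isOpen_univ hf.1 h.1.contDiffOn γ β x (mem_univ ξ), norm_mul, mul_assoc]
    exact mul_le_mul (hA x) (hC ξ) (norm_nonneg _) ((norm_nonneg _).trans (hA x))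

lemma iterPd2_zero (γ β : List (Fin n)) (x ξ : Pt n) :
    iterPd2 γ β (fun _ _ => (0 : ℂ)) x ξ = 0 := by
  have h := iterPd2_tensor (f := fun _ : Pt n => (0 : ℂ)) (σ := fun _ : Pt n => (0 : ℂ)) isOpen_univ
    contDiff_const contDiffOn_const γ β x (mem_univ ξ)
  have h0 : ∀ β : List (Fin n), iterPd β (fun _ : Pt n => (0 : ℂ)) = fun _ => 0 := by
    intro β
    induction β with
    | nil => rfl
    | cons i β ih => funext x; simp [iterPd_cons, pd, ih]
  have e : tensor (fun _ : Pt n => (0 : ℂ)) (fun _ : Pt n => (0 : ℂ)) = fun _ _ => 0 := by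
    funext x ξ
    simp [tensor]
  rw [← e, h, h0, zero_mul]

/-- `σ ↦ f ⊗ σ` is continuous from the rapidly decaying functions to the symbols of order `a`. -/
lemma exists_seminormsLE_tensor {χ : Pt n → ℝ} {U : Set (Pt n)} (a : ℂ) {f : Pt n → ℂ}
    (hf : f ∈ TestFun U) (m : ℕ) : ∃ (p A : ℝ), 0 < A ∧ ∀ (r : Fun1 n) (ε : ℝ), 0 ≤ ε →
      RapidDecay r → (∀ β : List (Fin n), β.length ≤ m → ∀ ξ,
        ‖iterPd β r ξ‖ ≤ ε * (1 + ‖ξ‖) ^ p) → SeminormsLE χ U a m (A * ε) (tensor f r) := by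
  obtain ⟨A, hA0, hA⟩ := exists_bound_iterPd (exists_bound_of_hasCompactSupport hf.1 hf.2.1) m
  -- The homogeneous components are taken to be `0`. The exponent is the worst case `N = |β| = m`
  -- among the seminorms.
  refine ⟨-(-a.re + m + m), A, hA0, fun r ε hε hr h => ⟨fun _ _ _ => 0,
    ⟨fun j => contDiffOn_const, by simp, fun N => ?_⟩,
    fun γ β hγ hβ => ⟨fun N hN x ξ => ?_, fun j hj x ξ hξ => ?_⟩⟩⟩
  · have : remainder χ (tensor f r) (fun _ _ _ => 0) N = tensor f r := by
      funext x ξ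
      simp [remainder]
    rw [this]
    exact isSymbol_tensor hf (hr.isSymbolCC _)
  · have : remainder χ (tensor f r) (fun _ _ _ => 0) N = tensor f r := by
      funext x ξ
      simp [remainder]
    rw [this, rpow_neg_mul_le_iff (by positivity) rfl,
      iterPd2_tensor isOpen_univ hf.1 hr.1.contDiffOn γ β x (mem_univ ξ), norm_mul, mul_assoc]
    refine mul_le_mul (hA γ hγ x) ((h β hβ ξ).trans ?_) (norm_nonneg _) hA0.le
    have h1 : (N : ℝ) ≤ m := by exact_mod_cast hN
    have h2 : (β.length : ℝ) ≤ m := by exact_mod_cast hβ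
    gcongr
    simp
  · rw [iterPd2_zero, norm_zero]
    positivity

/-- The bound is uniform in `x`, so convergence of symbols makes the fibrewise cut-off integrals
converge uniformly. -/
lemma exists_cutoffIntegral_slice_bound [NeZero n] {χ : Pt n → ℝ} (hχ : IsCutoff χ)
    (U : Set (Pt n)) (a : ℂ) : ∃ (m : ℕ) (C : ℝ), ∀ (σ : Fun2 n) (ε : ℝ),
      SeminormsLE χ U a m ε σ → ∀ x, ∃ c, HasCutoffIntegral (σ x) c ∧ ‖c‖ ≤ C * ε := by
  obtain ⟨m, C, H⟩ := exists_cutoffIntegral_bound hχ a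
  refine ⟨m, C, fun σ ε ⟨s, hs, h⟩ x => ?_⟩
  obtain ⟨h1, h2⟩ := h [] [] (by simp) (by simp)
  refine H (σ x) (fun j => s j x) (fun j => (contDiffOn_slice (hs.1 j) x).continuousOn)
    (fun j ξ hξ t ht => hs.2.1 j x ξ hξ t ht) ?_ ε (fun ξ => ?_) fun j hj ξ hξ => ?_
  · have : ContDiff ℝ ∞ (remainder χ σ s m x) := contDiffOn_univ.1
      (contDiffOn_slice (O := univ) (by simpa using (hs.2.2 m).1.contDiffOn) x)
    exact this.continuous
  · have := h1 m le_rfl x ξ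
    rw [rpow_neg_mul_le_iff (q := a.re - m) (by positivity) (by simp; ring)] at this
    exact this
  · exact h2 j hj.le x ξ hξ

/-! ### The cut-off integral over the cotangent bundle -/

/-- `I` is the integral over `U` of the fibrewise cut-off integrals of `σ`, which are integrable. -/
def HasCotangentIntegral (U : Set (Pt n)) (σ : Fun2 n) (I : ℂ) : Prop :=
  ∃ G : Pt n → ℂ, (∀ x, HasCutoffIntegral (σ x) (G x)) ∧ Continuous G ∧ IntegrableOn G U ∧
    I = ∫ x in U, G x

lemma HasCotangentIntegral.eq {U : Set (Pt n)} {σ : Fun2 n} {I : ℂ}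
    (h : HasCotangentIntegral U σ I) : cutoffIntegralCotangent U σ = I := by
  obtain ⟨G, h1, -, -, rfl⟩ := h
  simp only [cutoffIntegralCotangent, (h1 _).eq]

lemma HasCotangentIntegral.add {U : Set (Pt n)} {σ τ : Fun2 n} {I J : ℂ}
    (h : HasCotangentIntegral U σ I) (h' : HasCotangentIntegral U τ J) :
    HasCotangentIntegral U (σ + τ) (I + J) := by
  obtain ⟨G, h1, h2, h3, rfl⟩ := h
  obtain ⟨G', h1', h2', h3', rfl⟩ := h'
  exact ⟨fun x => G x + G' x, fun x => (h1 x).add (h1' x), h2.add h2', h3.add h3',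
    (integral_add h3 h3').symm⟩

lemma HasCotangentIntegral.smul {U : Set (Pt n)} {σ : Fun2 n} {I : ℂ}
    (h : HasCotangentIntegral U σ I) (a : ℂ) : HasCotangentIntegral U (a • σ) (a * I) := by
  obtain ⟨G, h1, h2, h3, rfl⟩ := h
  exact ⟨fun x => a * G x, fun x => (h1 x).smul a, h2.const_mul a, h3.const_mul a,
    (integral_const_mul a _).symm⟩

lemma HasCotangentIntegral.zero (U : Set (Pt n)) : HasCotangentIntegral U (0 : Fun2 n) 0 :=
  ⟨fun _ => 0, fun _ => .zero, continuous_const, integrableOn_zero, by simp⟩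

lemma hasCotangentIntegral_tensor {U : Set (Pt n)} {f : Pt n → ℂ} (hf : f ∈ TestFun U)
    {σ : Fun1 n} {c : ℂ} (h : HasCutoffIntegral σ c) :
    HasCotangentIntegral U (tensor f σ) ((∫ x, f x) * c) := by
  refine ⟨fun x => f x * c, fun x => h.smul (f x), hf.1.continuous.mul_const c,
    ((integrable_testFun hf).mul_const c).integrableOn, ?_⟩
  rw [integral_mul_const, setIntegral_eq_integral_of_forall_compl_eq_zero]
  exact fun x hx => image_eq_zero_of_notMem_tsupport fun h' => hx (hf.2.2 h')

/-- A symbol which is approximated, with supports in a fixed compact set, by symbols with a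
cotangent integral has one itself, and it is the limit. -/
lemma hasCotangentIntegral_of_approx [NeZero n] {χ : Pt n → ℝ} (hχ : IsCutoff χ)
    {U K : Set (Pt n)} (hK : IsCompact K) (a : ℂ) {σ : Fun2 n} (hσ : ∀ x, x ∉ K → σ x = 0)
    (T : Set (Fun2 n)) (hT : ∀ g ∈ T, ∃ I, HasCotangentIntegral U g I)
    (happrox : ∀ (m : ℕ) (ε : ℝ), 0 < ε → ∃ g ∈ T, (∀ x, x ∉ K → g x = 0) ∧
      SeminormsLE χ U a m ε (g - σ)) :
    ∃ (I : ℂ) (m : ℕ) (C : ℝ), HasCotangentIntegral U σ I ∧ ∀ g ∈ T, (∀ x, x ∉ K → g x = 0) →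
      ∀ ε, SeminormsLE χ U a m ε (g - σ) → ‖cutoffIntegralCotangent U g - I‖ ≤ C * ε := by
  obtain ⟨m, C, H⟩ := exists_cutoffIntegral_slice_bound hχ U a
  have key : ∀ g ∈ T, ∀ ε, SeminormsLE χ U a m ε (g - σ) → ∀ x,
      HasCutoffIntegral (σ x) (cutoffIntegral (σ x)) ∧
      ‖cutoffIntegral (g x) - cutoffIntegral (σ x)‖ ≤ C * ε := by
    intro g hg ε hε x
    obtain ⟨c, hc, hcε⟩ := H _ ε hε x
    obtain ⟨I, G, hG, -⟩ := hT g hg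
    -- Existence for `σ` is read off from `σ = g - (g - σ)`: both terms have cut-off integrals.
    have h1 : HasCutoffIntegral (σ x) (G x + (-1) * c) := by
      convert (hG x).add (hc.smul (-1)) using 1
      funext ξ
      simp
    refine ⟨by rwa [h1.eq], ?_⟩
    rw [h1.eq, (hG x).eq]
    simpa using hcε
  obtain ⟨g₀, hg₀, -, hs₀⟩ := happrox m 1 one_pos
  have hint : ∀ x, HasCutoffIntegral (σ x) (cutoffIntegral (σ x)) := fun x =>
    (key g₀ hg₀ 1 hs₀ x).1
  have hzero : ∀ g : Fun2 n, (∀ x, x ∉ K → g x = 0) → ∀ x, x ∉ K → cutoffIntegral (g x) = 0 := by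
    intro g hg x hx
    rw [hg x hx]
    exact HasCutoffIntegral.zero.eq
  -- A uniform limit of continuous functions; with the support in `K` this gives integrability over
  -- `U`.
  have hcont : Continuous fun x => cutoffIntegral (σ x) := by
    refine continuous_of_uniform_approx_of_continuous fun u hu => ?_
    obtain ⟨ε, hε, hεu⟩ := Metric.mem_uniformity_dist.1 hu
    obtain ⟨g, hg, -, hs⟩ := happrox m (ε / (|C| + 1)) (by positivity)
    obtain ⟨I, G, hG, hGc, -⟩ := hT g hg
    refine ⟨fun x => cutoffIntegral (g x), ?_, fun x => hεu ?_⟩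
    · simpa only [(hG _).eq] using hGc
    · rw [dist_comm, dist_eq_norm]
      refine ((key g hg _ hs x).2).trans_lt ?_
      have h1 : C * (ε / (|C| + 1)) ≤ |C| * (ε / (|C| + 1)) := by
        gcongr
        exact le_abs_self C
      refine h1.trans_lt ?_
      rw [mul_div_assoc', div_lt_iff₀ (by positivity)]
      nlinarith [abs_nonneg C]
  have hintegrable : ∀ g : Fun2 n, (∀ x, x ∉ K → g x = 0) →
      (Continuous fun x => cutoffIntegral (g x)) → Integrable fun x => cutoffIntegral (g x) :=
    fun g hg hc => hc.integrable_of_hasCompactSupport (HasCompactSupport.intro hK (hzero g hg))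
  refine ⟨_, m, C * volume.real K,
    ⟨_, hint, hcont, (hintegrable σ hσ hcont).integrableOn, rfl⟩, fun g hg hgK ε hs => ?_⟩
  obtain ⟨I, G, hG, hGc, -⟩ := hT g hg
  have hgc : Continuous fun x => cutoffIntegral (g x) := by simpa only [(hG _).eq] using hGc
  rw [cutoffIntegralCotangent, ← integral_sub (hintegrable g hgK hgc).integrableOn
    (hintegrable σ hσ hcont).integrableOn]
  have hC : ∀ x, ‖cutoffIntegral (g x) - cutoffIntegral (σ x)‖ ≤ K.indicator (fun _ => C * ε) x := by
    intro x
    by_cases hx : x ∈ K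
    · rw [indicator_of_mem hx]
      exact (key g hg ε hs x).2
    · rw [indicator_of_notMem hx, hzero g hgK x hx, hzero σ hσ x hx]
      simp
  have hI : Integrable (K.indicator fun _ => C * ε) (volume : Measure (Pt n)) :=
    (integrable_indicator_iff hK.measurableSet).2 (integrableOn_const hK.measure_lt_top.ne)
  refine (norm_integral_le_of_norm_le hI.integrableOn (.of_forall hC)).trans ?_
  refine (setIntegral_le_integral hI (.of_forall fun x => (norm_nonneg _).trans (hC x))).trans_eq ?_
  rw [integral_indicator hK.measurableSet, setIntegral_const, smul_eq_mul]
  ring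

/-! ### Linear functionals with Stokes' property -/

lemma IsLinearOn.map_add {D : Set (Fun2 n)} {ρ : Fun2 n → ℂ} (h : IsLinearOn D ρ) {σ τ : Fun2 n}
    (hσ : σ ∈ D) (hτ : τ ∈ D) (hs : σ + τ ∈ D) : ρ (σ + τ) = ρ σ + ρ τ := by
  have := h σ hσ τ hτ 1 1 (by simpa using hs)
  simpa using this

lemma IsLinearOn.map_smul {D : Set (Fun2 n)} {ρ : Fun2 n → ℂ} (h : IsLinearOn D ρ) {σ : Fun2 n}
    (hσ : σ ∈ D) (c : ℂ) (hs : c • σ ∈ D) : ρ (c • σ) = c * ρ σ := by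
  have := h σ hσ σ hσ c 0 (by simpa using hs)
  simpa using this

lemma IsLinearOn.map_zero {D : Set (Fun2 n)} {ρ : Fun2 n → ℂ} (h : IsLinearOn D ρ)
    (h0 : (0 : Fun2 n) ∈ D) : ρ 0 = 0 := by
  have := h.map_smul h0 0 (by simpa using h0)
  simpa using this

lemma tensor_add_left (f g : Pt n → ℂ) (σ : Fun1 n) :
    tensor (f + g) σ = tensor f σ + tensor g σ := by
  funext x ξ
  simp [tensor, add_mul]

lemma tensor_add_right (f : Pt n → ℂ) (σ τ : Fun1 n) :
    tensor f (σ + τ) = tensor f σ + tensor f τ := by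
  funext x ξ
  simp [tensor, mul_add]

lemma tensor_smul_left (c : ℂ) (f : Pt n → ℂ) (σ : Fun1 n) :
    tensor (c • f) σ = c • tensor f σ := by
  funext x ξ
  simp [tensor, mul_assoc]

lemma tensor_smul_right (c : ℂ) (f : Pt n → ℂ) (σ : Fun1 n) :
    tensor f (c • σ) = c • tensor f σ := by
  funext x ξ
  simp [tensor, mul_left_comm]

lemma tensor_pd_left {f : Pt n → ℂ} (hf : ContDiff ℝ ∞ f) (σ : Fun1 n) (i : Fin n) :
    tensor (pd i f) σ = pdx i (tensor f σ) := by
  funext x ξ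
  have : fderiv ℝ (fun y => f y * σ ξ) x = σ ξ • fderiv ℝ f x :=
    ((hf.differentiable (by simp) x).hasFDerivAt.mul_const (σ ξ)).fderiv
  simp [tensor, pdx, pd, this, mul_comm]

lemma tensor_pd_right (f : Pt n → ℂ) {σ : Fun1 n} (hσ : ContDiff ℝ ∞ σ) (i : Fin n) :
    tensor f (pd i σ) = pdxi i (tensor f σ) := by
  funext x ξ
  have : fderiv ℝ (fun η => f x * σ η) ξ = f x • fderiv ℝ σ ξ :=
    ((hσ.differentiable (by simp) ξ).hasFDerivAt.const_mul (f x)).fderiv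
  simp [tensor, pdxi, pd, this]

section

variable {χ : Pt n → ℝ} {U : Set (Pt n)} {D : Set (Fun2 n)} {ρ : Fun2 n → ℂ}

/-- `D` need not be a subspace, but `(f + g) ⊗ σ` is again a single tensor, so the definition of the
slice keeps the sums in `D`. -/
lemma killsDerivatives_left (hD : D ⊆ CScpt χ U) (hlin : IsLinearOn D ρ) (hst : Stokes χ U D ρ)
    {σ : Fun1 n} (hσ : σ ∈ slice χ U D) : KillsDerivatives U (fun f => ρ (tensor f σ)) where
  add f hf g hg := by
    have h := hσ.2 _ (add_mem_testFun hf hg)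
    rw [tensor_add_left] at h ⊢
    exact hlin.map_add (hσ.2 f hf) (hσ.2 g hg) h
  smul f hf c := by
    have h := hσ.2 _ (smul_mem_testFun hf c)
    rw [tensor_smul_left] at h ⊢
    exact hlin.map_smul (hσ.2 f hf) c h
  pd f hf i := by
    have h := hσ.2 _ (pd_mem_testFun hf i)
    rw [tensor_pd_left hf.1] at h ⊢
    exact (hst _ (hD (hσ.2 f hf)) i).2 h

lemma killsDerivatives_right (hD : D ⊆ CScpt χ U) (hlin : IsLinearOn D ρ)
    (hst : Stokes χ U D ρ) (hsm : CSccSmoothing χ ⊆ slice χ U D) {f : Pt n → ℂ}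
    (hf : f ∈ TestFun U) : KillsDerivatives univ (fun r => ρ (tensor f r)) := by
  have hmem : ∀ r ∈ TestFun univ, tensor f r ∈ D := fun r hr =>
    (hsm ((rapidDecay_of_testFun hr).mem_smoothing χ)).2 f hf
  refine ⟨fun r hr s hs => ?_, fun r hr c => ?_, fun r hr i => ?_⟩
  · have h := hmem _ (add_mem_testFun hr hs)
    rw [tensor_add_right] at h ⊢
    exact hlin.map_add (hmem r hr) (hmem s hs) h
  · have h := hmem _ (smul_mem_testFun hr c)
    rw [tensor_smul_right] at h ⊢
    exact hlin.map_smul (hmem r hr) c h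
  · have h := hmem _ (pd_mem_testFun hr i)
    rw [tensor_pd_right f hr.1] at h ⊢
    exact (hst _ (hD (hmem r hr)) i).1 h

lemma tensor_mem_tensorSpan {S : Set (Fun1 n)} {a : ℂ} {f : Pt n → ℂ} (hf : f ∈ TestFun U)
    {σ : Fun1 n} (hσ : σ ∈ S) (ha : σ ∈ CSccOrd χ a) : tensor f σ ∈ tensorSpan χ U S a :=
  Submodule.subset_span ⟨f, hf, σ, ⟨hσ, ha⟩, rfl⟩

lemma tendsto_integral_sub_tail (hχ : IsCutoff χ) {r : Fun1 n} (hr : RapidDecay r) :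
    Tendsto (fun k : ℕ => ∫ ξ, (r - tail χ r (k + 1)) ξ) atTop (𝓝 (∫ ξ, r ξ)) := by
  obtain ⟨C, hC0, hC⟩ := hr.exists_tail_bound hχ 0 (-(n + 1))
  have hI : Integrable (fun ξ : Pt n => (1 + ‖ξ‖) ^ (-(n + 1 : ℝ))) :=
    integrable_one_add_norm (by simp)
  have h1 : Tendsto (fun k : ℕ => ∫ ξ, tail χ r (k + 1) ξ) atTop (𝓝 0) := by
    refine squeeze_zero_norm (a := fun k : ℕ => C / ((k : ℝ) + 1) *
      ∫ ξ : Pt n, (1 + ‖ξ‖) ^ (-(n + 1 : ℝ))) (fun k => ?_) ?_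
    · rw [← integral_const_mul]
      refine norm_integral_le_of_norm_le (hI.const_mul _) (.of_forall fun ξ => ?_)
      have := hC (k + 1) k.succ_pos [] (by simp) ξ
      simpa [iterPd] using this
    · have h2 : Tendsto (fun k : ℕ => C / ((k : ℝ) + 1)) atTop (𝓝 0) :=
        tendsto_const_nhds.div_atTop (tendsto_atTop_add_const_right _ _ tendsto_natCast_atTop_atTop)
      simpa using h2.mul_const (∫ ξ : Pt n, (1 + ‖ξ‖) ^ (-(n + 1 : ℝ)))
  have h3 := (tendsto_const_nhds (x := ∫ ξ, r ξ)).sub h1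
  rw [sub_zero] at h3
  refine h3.congr fun k => ?_
  rw [← integral_sub hr.integrable (hr.tail hχ k.succ_pos).integrable]
  rfl

lemma tendsto_rho_sub_tail (hχ : IsCutoff χ) (hsm : CSccSmoothing χ ⊆ slice χ U D)
    (hsub : ∀ a, (tensorSpan χ U (slice χ U D) a : Set (Fun2 n)) ⊆ D ∩ CScptOrd χ U a)
    (hcont : IsContinuousOnOrders χ U D ρ) {f : Pt n → ℂ} (hf : f ∈ TestFun U) {r : Fun1 n}
    (hr : RapidDecay r) :
    Tendsto (fun k : ℕ => ρ (tensor f (r - tail χ r (k + 1)))) atTop (𝓝 (ρ (tensor f r))) := by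
  have hmem : ∀ r : Fun1 n, RapidDecay r → tensor f r ∈ D ∩ CScptOrd χ U 0 := fun r hr =>
    hsub 0 (tensor_mem_tensorSpan hf (hsm (hr.mem_smoothing χ))
      (mem_iInter.1 (hr.mem_smoothing χ) 0))
  have hK : ∀ r : Fun1 n, ∀ x, x ∉ tsupport f → tensor f r x = 0 := fun r x hx => by
    funext ξ
    simp [tensor, image_eq_zero_of_notMem_tsupport hx]
  rw [Metric.tendsto_atTop]
  intro ε hε
  -- Smoothing symbols have every order, so order `0` serves; all the tensors are supported over the
  -- support of `f`.
  obtain ⟨m, δ, hδ, H⟩ := hcont 0 _ hf.2.1.isCompact hf.2.2 _ (hmem r hr) (hK r) ε hε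
  obtain ⟨p, A, hA, hS⟩ := exists_seminormsLE_tensor (χ := χ) 0 (smul_mem_testFun hf (-1)) m
  obtain ⟨C, hC0, hC⟩ := hr.exists_tail_bound hχ m p
  obtain ⟨k₀, hk₀⟩ := exists_nat_gt (A * C / δ)
  refine ⟨k₀, fun k hk => ?_⟩
  rw [dist_eq_norm]
  refine H _ (hmem _ (rapidDecay_of_testFun (sub_tail_mem_testFun hχ hr k.succ_pos))) (hK _) ?_
  have e : tensor f (r - tail χ r (k + 1)) - tensor f r
      = tensor ((-1 : ℂ) • f) (tail χ r (k + 1)) := by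
    funext x ξ
    simp [tensor, mul_sub]
  rw [e]
  refine (hS _ (C / (k + 1 : ℕ)) (by positivity) (hr.tail hχ k.succ_pos)
    (hC (k + 1) k.succ_pos)).mono le_rfl ?_
  have hk' : (k₀ : ℝ) ≤ k := by exact_mod_cast hk
  push_cast
  rw [mul_div_assoc', div_le_iff₀ (by positivity)]
  rw [div_lt_iff₀ hδ] at hk₀
  nlinarith

/-- On `f ⊗ r` with `r` smoothing, `ρ` is a multiple of the integral. -/
lemma exists_rho_smoothing (hχ : IsCutoff χ) (hUo : IsOpen U) (hUc : IsConnected U)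
    (hD : D ⊆ CScpt χ U) (hsm : CSccSmoothing χ ⊆ slice χ U D)
    (hsub : ∀ a, (tensorSpan χ U (slice χ U D) a : Set (Fun2 n)) ⊆ D ∩ CScptOrd χ U a)
    (hlin : IsLinearOn D ρ) (hcont : IsContinuousOnOrders χ U D ρ) (hst : Stokes χ U D ρ) :
    ∃ c : ℂ, ∀ f ∈ TestFun U, ∀ r ∈ CSccSmoothing χ,
      ρ (tensor f r) = c * ((∫ x, f x) * ∫ ξ, r ξ) := by
  obtain ⟨f₀, hf₀, hi₀⟩ := exists_testFun_integral_ne_zero hUo hUc.nonempty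
  obtain ⟨c, hc⟩ := (killsDerivatives_right hD hlin hst hsm hf₀).exists_eq_integral isOpen_univ
    isConnected_univ
  refine ⟨c, fun f hf r hr => ?_⟩
  have hr' := rapidDecay_of_mem_smoothing hr
  have h1 : ρ (tensor f₀ r) = c * ∫ ξ, r ξ := by
    refine tendsto_nhds_unique (tendsto_rho_sub_tail hχ hsm hsub hcont hf₀ hr')
      (((tendsto_integral_sub_tail hχ hr').const_mul c).congr fun k => ?_)
    exact (hc _ (sub_tail_mem_testFun hχ hr' k.succ_pos)).symm
  -- The constant `d` depends on `r`; evaluation at `f₀`, of integral `1`, identifies it as `c ∫ r`.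
  obtain ⟨d, hd⟩ := (killsDerivatives_left hD hlin hst (hsm hr)).exists_eq_integral hUo hUc
  have h2 := hd f₀ hf₀
  rw [hi₀, mul_one] at h2
  have h3 := hd f hf
  rw [h3, ← h2, h1]
  ring

/-- On `f ⊗ σ` with `σ` of order `a`, `ρ` is a multiple of the cut-off integral. -/
lemma rho_tensor [NeZero n] (hχ : IsCutoff χ) (hD : D ⊆ CScpt χ U)
    (hS : IsAdmissible χ (slice χ U D))
    (hsub : ∀ a, (tensorSpan χ U (slice χ U D) a : Set (Fun2 n)) ⊆ D ∩ CScptOrd χ U a)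
    (hlin : IsLinearOn D ρ) (hst : Stokes χ U D ρ) {c : ℂ}
    (hc : ∀ f ∈ TestFun U, ∀ r ∈ CSccSmoothing χ, ρ (tensor f r) = c * ((∫ x, f x) * ∫ ξ, r ξ))
    {a : ℂ} {σ : Fun1 n} (hσ : σ ∈ slice χ U D) (ha : σ ∈ CSccOrd χ a) {f : Pt n → ℂ}
    (hf : f ∈ TestFun U) :
    ∃ I, HasCotangentIntegral U (tensor f σ) I ∧ ρ (tensor f σ) = c * I := by
  obtain ⟨τ, t, hτ, hr, hτS, hdS, -⟩ := hS.exists_primitives a σ hσ ha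
  set r := σ - ∑ i, pd i (τ i) with hr_def
  have hrS := hS.smoothing_subset hr
  have hrd := rapidDecay_of_mem_smoothing hr
  have hexp : ∀ i, pd i (τ i) ∈ CSccOrd χ a := fun i => ⟨_, (hτ i).pd hχ i⟩
  have hτ0 : ∀ i, HasCutoffIntegral (pd i (τ i)) 0 := fun i => by
    obtain ⟨e, he⟩ := ((hτ i).pd hχ i).exists_hasCutoffIntegral hχ
    have h0 := hS.stokes_cutoffIntegral (τ i) (hτS i).1 i (hdS i)
    rw [he.eq] at h0
    rwa [h0] at he
  have hσI : HasCutoffIntegral σ (∫ ξ, r ξ) := by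
    have := (HasCutoffIntegral.of_integrable hrd.integrable).add
      (HasCutoffIntegral.sum Finset.univ fun i _ => hτ0 i)
    simpa [hr_def] using this
  refine ⟨_, hasCotangentIntegral_tensor hf hσI, ?_⟩
  -- The derivatives are added one at a time: linearity of `ρ` requires every partial sum to lie in
  -- `D`, which the inclusion of the tensor span in `D` provides.
  have hrho : ∀ s : Finset (Fin n),
      tensor f (r + ∑ i ∈ s, pd i (τ i)) ∈ tensorSpan χ U (slice χ U D) a ∧
      ρ (tensor f (r + ∑ i ∈ s, pd i (τ i))) = ρ (tensor f r) := by
    intro s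
    induction s using Finset.induction_on with
    | empty =>
      simpa using tensor_mem_tensorSpan hf hrS (mem_iInter.1 hr a)
    | insert i s hi ih =>
      have h1 : tensor f (r + ∑ j ∈ insert i s, pd j (τ j))
          = tensor f (pd i (τ i)) + tensor f (r + ∑ j ∈ s, pd j (τ j)) := by
        rw [Finset.sum_insert hi, ← tensor_add_right, add_left_comm]
      have h2 := tensor_mem_tensorSpan hf (hdS i) (hexp i)
      have h3 := Submodule.add_mem _ h2 ih.1
      rw [h1]
      refine ⟨h3, ?_⟩
      rw [hlin.map_add (hsub a h2).1 (hsub a ih.1).1 (hsub a h3).1, ih.2]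
      have h4 := (hsub a h2).1
      rw [tensor_pd_right f (hτ i).contDiff] at h4 ⊢
      rw [(hst _ (hD ((hτS i).2 f hf)) i).1 h4, zero_add]
  have h5 := (hrho Finset.univ).2
  rw [hr_def, sub_add_cancel, ← hr_def] at h5
  rw [h5, hc f hf r hr]

lemma rho_tensorSpan {c : ℂ}
    (hsub : ∀ a, (tensorSpan χ U (slice χ U D) a : Set (Fun2 n)) ⊆ D ∩ CScptOrd χ U a)
    (hlin : IsLinearOn D ρ) {a : ℂ}
    (h : ∀ σ ∈ slice χ U D, σ ∈ CSccOrd χ a → ∀ f ∈ TestFun U,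
      ∃ I, HasCotangentIntegral U (tensor f σ) I ∧ ρ (tensor f σ) = c * I)
    {g : Fun2 n} (hg : g ∈ tensorSpan χ U (slice χ U D) a) :
    ∃ I, HasCotangentIntegral U g I ∧ ρ g = c * I := by
  induction hg using Submodule.span_induction with
  | mem g hg =>
    obtain ⟨f, hf, σ, hσ, rfl⟩ := hg
    exact h σ hσ.1 hσ.2 f hf
  | zero =>
    exact ⟨0, .zero U, by rw [hlin.map_zero (hsub a (Submodule.zero_mem _)).1, mul_zero]⟩
  | add g g' hg hg' ih ih' =>
    obtain ⟨I, hI, h1⟩ := ih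
    obtain ⟨I', hI', h1'⟩ := ih'
    refine ⟨_, hI.add hI', ?_⟩
    rw [hlin.map_add (hsub a hg).1 (hsub a hg').1 (hsub a (Submodule.add_mem _ hg hg')).1, h1, h1',
      mul_add]
  | smul b g hg ih =>
    obtain ⟨I, hI, h1⟩ := ih
    refine ⟨_, hI.smul b, ?_⟩
    rw [hlin.map_smul (hsub a hg).1 b (hsub a (Submodule.smul_mem _ b hg)).1, h1]
    ring

/-! ### Passage from tensors to all symbols by density -/

lemma mulX_mem_tensorSpan {S : Set (Fun1 n)} {a : ℂ} {ψ : Pt n → ℂ} (hψ : ψ ∈ TestFun U)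
    {g : Fun2 n} (hg : g ∈ tensorSpan χ U S a) : mulX ψ g ∈ tensorSpan χ U S a := by
  induction hg using Submodule.span_induction with
  | mem g hg =>
    obtain ⟨f, hf, σ, hσ, rfl⟩ := hg
    have : mulX ψ (tensor f σ) = tensor (fun x => ψ x * f x) σ := by
      funext x ξ
      simp [mulX, tensor, mul_assoc]
    rw [this]
    exact tensor_mem_tensorSpan (mul_mem_testFun hf hψ.1) hσ.1 hσ.2
  | zero =>
    have : mulX ψ (0 : Fun2 n) = 0 := by
      funext x ξ
      simp [mulX]
    rw [this]
    exact Submodule.zero_mem _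
  | add g g' _ _ ih ih' =>
    have : mulX ψ (g + g') = mulX ψ g + mulX ψ g' := by
      funext x ξ
      simp [mulX, mul_add]
    rw [this]
    exact Submodule.add_mem _ ih ih'
  | smul b g _ ih =>
    have : mulX ψ (b • g) = b • mulX ψ g := by
      funext x ξ
      simp [mulX, mul_left_comm]
    rw [this]
    exact Submodule.smul_mem _ b ih

lemma exists_compact_support {a : ℂ} {σ : Fun2 n} (h : σ ∈ CScptOrd χ U a) :
    ∃ K, IsCompact K ∧ K ⊆ U ∧ ∀ x, x ∉ K → σ x = 0 := by
  obtain ⟨s, hs⟩ := h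
  obtain ⟨K, hK, hKU, h0⟩ := (hs.2.2 0).2.1
  refine ⟨K, hK, hKU, fun x hx => ?_⟩
  funext ξ
  simpa [remainder] using h0 x hx ξ

/-- On the symbols of order `a` in `D`, `ρ` is a multiple of the cut-off integral. -/
lemma rho_of_order [NeZero n] (hχ : IsCutoff χ) (hUo : IsOpen U)
    (hdense : ∀ a : ℂ, IsDenseIn χ U a (tensorSpan χ U (slice χ U D) a) (D ∩ CScptOrd χ U a))
    (hcont : IsContinuousOnOrders χ U D ρ) {c a : ℂ}
    (h : ∀ g ∈ tensorSpan χ U (slice χ U D) a, ∃ I, HasCotangentIntegral U g I ∧ ρ g = c * I)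
    {σ : Fun2 n} (hσ : σ ∈ D ∩ CScptOrd χ U a) :
    ∃ I, HasCotangentIntegral U σ I ∧ ρ σ = c * I := by
  obtain ⟨K, hK, hKU, hσK⟩ := exists_compact_support hσ.2
  -- Density does not control supports. Multiplication by `ψ` fixes `σ` and forces the approximants
  -- to live over the compact support of `ψ`.
  obtain ⟨ψ, hψ, V, -, hKV, hψ1⟩ := exists_testFun_eq_one hK hUo hKU
  have hKψ : K ⊆ tsupport ψ := fun x hx =>
    subset_tsupport ψ (by simp [hψ1 x (hKV hx)])
  have hσψ : ∀ x, x ∉ tsupport ψ → σ x = 0 := fun x hx => hσK x fun h => hx (hKψ h)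
  have hψσ : mulX ψ σ = σ := by
    funext x ξ
    by_cases hx : x ∈ K
    · simp [mulX, hψ1 x (hKV hx)]
    · simp [mulX, hσK x hx]
  have happrox : ∀ (m : ℕ) (ε : ℝ), 0 < ε → ∃ g ∈ tensorSpan χ U (slice χ U D) a,
      (∀ x, x ∉ tsupport ψ → g x = 0) ∧ SeminormsLE χ U a m ε (g - σ) := by
    intro m ε hε
    obtain ⟨C, hC0, hC⟩ := exists_seminormsLE_mulX (χ := χ) a hψ m
    obtain ⟨g, hg, hs⟩ := (hdense a).2 σ hσ m (ε / C) (by positivity)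
    refine ⟨mulX ψ g, mulX_mem_tensorSpan hψ hg, fun x hx => ?_, ?_⟩
    · funext ξ
      simp [mulX, image_eq_zero_of_notMem_tsupport hx]
    · have h1 := hC _ _ (by positivity) hs
      rw [mul_div_cancel₀ _ hC0.ne'] at h1
      have e : mulX ψ (g - σ) = mulX ψ g - σ := by
        conv_rhs => rw [← hψσ]
        funext x ξ
        simp [mulX, mul_sub]
      rwa [e] at h1
  obtain ⟨I, m₀, C, hI, happ⟩ := hasCotangentIntegral_of_approx hχ hψ.2.1.isCompact a hσψ
    (tensorSpan χ U (slice χ U D) a) (fun g hg => (h g hg).imp fun _ h => h.1) happrox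
  refine ⟨I, hI, ?_⟩
  rw [← sub_eq_zero, ← norm_le_zero_iff]
  refine le_of_forall_pos_le_add fun ε hε => ?_
  obtain ⟨m, δ, hδ, H⟩ := hcont a _ hψ.2.1.isCompact hψ.2.2 σ hσ hσψ (ε / 2) (by positivity)
  -- One approximant serves both continuity estimates; each accounts for `ε / 2`, and the `+ 1`
  -- guards against a zero denominator.
  obtain ⟨g, hg, hgψ, hs⟩ := happrox (max m m₀) (min δ (ε / (2 * (‖c‖ * |C| + 1)))) (by positivity)
  have h1 := H g ((hdense a).1 hg) hgψ (hs.mono (le_max_left _ _) (min_le_left _ _))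
  have h2 := happ g hg hgψ _ (hs.mono (le_max_right _ _) (min_le_right _ _))
  obtain ⟨J, hJ, hρ⟩ := h g hg
  rw [hJ.eq] at h2
  have h3 : ‖c * (J - I)‖ ≤ ε / 2 := by
    rw [norm_mul]
    calc ‖c‖ * ‖J - I‖ ≤ ‖c‖ * (C * (ε / (2 * (‖c‖ * |C| + 1)))) := by gcongr
      _ ≤ ‖c‖ * (|C| * (ε / (2 * (‖c‖ * |C| + 1)))) := by
        gcongr
        exact le_abs_self C
      _ = ε / 2 * ((‖c‖ * |C|) / (‖c‖ * |C| + 1)) := by field_simp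
      _ ≤ ε / 2 * 1 := by
        gcongr
        rw [div_le_one (by positivity)]
        linarith
      _ = ε / 2 := mul_one _
  have e : ρ σ - c * I = -(ρ g - ρ σ) + c * (J - I) := by
    rw [hρ]
    ring
  rw [e, zero_add]
  refine (norm_add_le _ _).trans ?_
  rw [norm_neg]
  linarith

/-- The partial sums lie in `D`, so linearity applies one summand at a time although the orders
differ. -/
lemma rho_of_sum {c : ℂ} (hlin : IsLinearOn D ρ)
    (h : ∀ a : ℂ, ∀ σ ∈ D ∩ CScptOrd χ U a, ∃ I, HasCotangentIntegral U σ I ∧ ρ σ = c * I)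
    {m : ℕ} {τ : ℕ → Fun2 n} (h1 : ∀ k < m, ∃ a, τ k ∈ D ∩ CScptOrd χ U a)
    (h2 : ∀ k ≤ m, ∑ i ∈ Finset.range k, τ i ∈ D) :
    ∃ I, HasCotangentIntegral U (∑ i ∈ Finset.range m, τ i) I ∧
      ρ (∑ i ∈ Finset.range m, τ i) = c * I := by
  induction m with
  | zero =>
    have h0 := h2 0 le_rfl
    rw [Finset.sum_range_zero] at h0 ⊢
    exact ⟨0, .zero U, by rw [hlin.map_zero h0, mul_zero]⟩
  | succ m ih =>
    obtain ⟨I, hI, h3⟩ := ih (fun k hk => h1 k (by omega)) fun k hk => h2 k (by omega)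
    obtain ⟨a, ha⟩ := h1 m (by omega)
    obtain ⟨J, hJ, h4⟩ := h a _ ha
    have h5 := h2 (m + 1) le_rfl
    rw [Finset.sum_range_succ] at h5 ⊢
    exact ⟨_, hI.add hJ, by rw [hlin.map_add (h2 m (by omega)) ha.1 h5, h3, h4, mul_add]⟩

end

end StokesSymbols

end

theorem mainTheorem7 (n : ℕ) (hn : 2 ≤ n)
    (χ : StokesSymbols.Pt n → ℝ) (hχ : StokesSymbols.IsCutoff χ)
    (U : Set (StokesSymbols.Pt n)) (hUo : IsOpen U) (hUc : IsConnected U)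
    (D : Set (StokesSymbols.Fun2 n))
    (hD : D ⊆ StokesSymbols.CScpt χ U)
    (hDord : StokesSymbols.IsSumOfOrders χ U D)
    (hDsm : StokesSymbols.CScptSmoothing χ U ⊆ D)
    (hDmul : ∀ f ∈ StokesSymbols.TestFun U, ∀ σ ∈ D, (fun x ξ => f x * σ x ξ) ∈ D)
    (hS : StokesSymbols.IsAdmissible χ (StokesSymbols.slice χ U D))
    (hdense : ∀ a : ℂ, StokesSymbols.IsDenseIn χ U a
      (StokesSymbols.tensorSpan χ U (StokesSymbols.slice χ U D) a)
      (D ∩ StokesSymbols.CScptOrd χ U a))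
    (ρ : StokesSymbols.Fun2 n → ℂ)
    (hlin : StokesSymbols.IsLinearOn D ρ)
    (hcont : StokesSymbols.IsContinuousOnOrders χ U D ρ)
    (hstokes : StokesSymbols.Stokes χ U D ρ) :
    ∃ c : ℂ, ∀ σ ∈ D, ρ σ = c * StokesSymbols.cutoffIntegralCotangent U σ := by
  have : NeZero n := ⟨by omega⟩
  have hsub : ∀ a, (StokesSymbols.tensorSpan χ U (StokesSymbols.slice χ U D) a :
      Set (StokesSymbols.Fun2 n)) ⊆ D ∩ StokesSymbols.CScptOrd χ U a := fun a => (hdense a).1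
  obtain ⟨c, hc⟩ := StokesSymbols.exists_rho_smoothing hχ hUo hUc hD hS.smoothing_subset hsub
    hlin hcont hstokes
  refine ⟨c, fun σ hσ => ?_⟩
  obtain ⟨m, τ, h1, h2, rfl⟩ := hDord σ hσ
  obtain ⟨I, hI, h3⟩ := StokesSymbols.rho_of_sum hlin (fun a _ h =>
    StokesSymbols.rho_of_order hχ hUo hdense hcont (fun _ hg =>
      StokesSymbols.rho_tensorSpan hsub hlin (fun _ hσ ha _ hf =>
        StokesSymbols.rho_tensor hχ hD hS hsub hlin hstokes hc hσ ha hf) hg) h) h1 h2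
  rw [h3, hI.eq]
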